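/- Let $G$ be a finite group and let $M$ be a $G$-lattice (a free abelian group of finite rank with an additive action of $G$). For a Galois extension $K/k$ of fields of characteristic zero with an identification $G\cong\mathrm{Gal}(K/k)$, let $G$ act on the group ring $K[M]$ by $g\cdot(a\chi^m)=g(a)\chi^{gm}$, let $K(M)$ be the fraction field of $K[M]$ with the induced action, and let $T=\mathrm{Spec}(K[M]^G)$ be the algebraic $k$-torus split by $K$ with character lattice $M$. We say that - every torus with character lattice $M$ is rational (respectively stably rational) if, for every such $K/k$, the torus $T$ is $k$-rational, i.e. its function field is $k(z_1,\dots,z_d)$ with $z_1,\dots,z_d$ algebraically independent over $k$ (respectively $T\times_k\mathbb A^s_k$ is $k$-rational for some $s\ge 0$); - every torus with character lattice $M$ is linearisable if, for every such $K/k$, there are a finite-dimensional $k$-linear representation $V$ of $G$ and a $G$-equivariant $K$-isomorphism $K(M)\cong K(V)$, where $K(V)$ is the fraction field of the polynomial ring over $K$ on a $k$-basis of $V$, with $G$ acting through its actions on $K$ and on $V$; - $M$ is hereditarily rational if, for every subgroup $H\le G$, every torus with splitting group $H$ and character lattice $\mathrm{Res}^G_H M$ is rational in the above sense. For $n\ge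 0$ let $G^n\rtimes S_n$ be the wreath product, let $P_n=\bigoplus_{i=1}^n\mathbb Z e_i$, and let $M\otimes P_n$ be the $G^n\rtimes S_n$-lattice with $$g\cdot(m\otimes e_i)=(g_i m)\otimes e_i\quad(g=(g_1,\dots,g_n)\in G^n),\qquad \sigma\cdot(m\otimes e_i)=m\otimes e_{\sigma(i)}\quad(\sigma\in S_n).$$ Then, for every $n$: 1. if every torus with character lattice $M$ is rational, then so is every torus with character lattice the $G^n\rtimes S_n$-lattice $M\otimes P_n$; 2. if every torus with character lattice $M$ is stably rational, then so is every torus with character lattice the $G^n\rtimes S_n$-lattice $M\otimes P_n$; 3. if every torus with character lattice $M$ is linearisable, then so is every torus with character lattice the $G^n\rtimes S_n$-lattice $M\otimes P_n$. Moreover, if the $G$-lattice $M$ is hereditarily rational, then so is the $G^2\rtimes S_2$-lattice $M\otimes P_2$. -/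

import Mathlib

open scoped TensorProduct

universe u

namespace WreathTorus

section Rationality

/-- A field extension `E / k` is rational if `E = k(z₁, …, z_d)` for some elements
`z₁, …, z_d` of `E` that are algebraically independent over `k`. -/
def IsRationalExtension (k E : Type*) [Field k] [Field E] [Algebra k E] : Prop :=
  ∃ (d : ℕ) (z : Fin d → E),
    AlgebraicIndependent k z ∧ IntermediateField.adjoin k (Set.range z) = ⊤

/-- The integral affine `k`-scheme `X = Spec R` is `k`-rational: its function field `Frac R` is
a rational extension of `k`. -/
def IsRational (k R : Type*) [Field k] [CommRing R] [IsDomain R] [Algebra k R] : Prop :=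
  IsRationalExtension k (FractionRing R)

/-- The integral affine `k`-scheme `X = Spec R` is stably `k`-rational: `X × 𝔸ˢ = Spec R[x₁, …, xₛ]`
is `k`-rational for some `s ≥ 0`. -/
def IsStablyRational (k R : Type*) [Field k] [CommRing R] [IsDomain R] [Algebra k R] : Prop :=
  ∃ s : ℕ, IsRational k (MvPolynomial (Fin s) R)

end Rationality

section Extend

variable {k A G : Type*} [Field k] [CommRing A] [Algebra k A] [Group G]

/-- An action of a group `G` on a `k`-algebra `A`, as an action by automorphisms. -/
noncomputable def toAut (a : G →* (A →ₐ[k] A)) : G →* (A ≃ₐ[k] A) :=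
  (AlgEquiv.algHomUnitsEquiv k A).toMonoidHom.comp a.toHomUnits

/-- The action of `G` on the fraction field of a domain `A` that extends its action on `A`. -/
noncomputable def fracAction [IsDomain A] (a : G →* (A →ₐ[k] A)) :
    G →* (FractionRing A ≃ₐ[k] FractionRing A) :=
  (IsFractionRing.fieldEquivOfAlgEquivHom k (FractionRing A)).comp (toAut a)

theorem fracAction_algebraMap [IsDomain A] (a : G →* (A →ₐ[k] A)) (g : G) (x : A) :
    fracAction a g (algebraMap A (FractionRing A) x) = algebraMap A (FractionRing A) (a g x) := by
  simp only [fracAction, MonoidHom.comp_apply, IsFractionRing.fieldEquivOfAlgEquivHom_apply,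
    IsFractionRing.fieldEquivOfAlgEquiv_algebraMap]
  rfl

end Extend

section Torus

variable {k K G M : Type*} [Field k] [Field K] [Algebra k K] [Group G] [AddCommGroup M]
  [DistribMulAction G M]

variable (M) in
/-- For a Galois extension `K / k` with group `G` (identified by `e`) and a `G`-lattice `M`,
the action of `G` on the group ring `K[M]`: `g · (a χᵐ) = g(a) χ^{g m}`. -/
noncomputable def latticeAction (e : G ≃* (K ≃ₐ[k] K)) :
    G →* (AddMonoidAlgebra K M →ₐ[k] AddMonoidAlgebra K M) where
  toFun g := (AddMonoidAlgebra.mapDomainAlgHom k K (DistribSMul.toAddMonoidHom M g)).comp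
    (AddMonoidAlgebra.mapAlgHom M (e g).toAlgHom)
  map_one' := by ext <;> simp
  map_mul' g h := by ext <;> simp [mul_smul]

theorem latticeAction_single (e : G ≃* (K ≃ₐ[k] K)) (g : G) (m : M) (a : K) :
    latticeAction M e g (AddMonoidAlgebra.single m a) =
      AddMonoidAlgebra.single (g • m) (e g a) := by
  simp [latticeAction]

variable (M) in
/-- The coordinate ring `K[M]^G` of the algebraic `k`-torus `T = Spec (K[M]^G)` with character
lattice `M` that is split by the Galois extension `K / k` with group `G`. -/
noncomputable def torusRing (e : G ≃* (K ≃ₐ[k] K)) : Subalgebra k (AddMonoidAlgebra K M) where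
  carrier := {x | ∀ g : G, latticeAction M e g x = x}
  mul_mem' hx hy g := by rw [map_mul, hx g, hy g]
  add_mem' hx hy g := by rw [map_add, hx g, hy g]
  algebraMap_mem' r g := AlgHom.commutes _ r

instance uniqueSums_of_free [Module.Free ℤ M] : UniqueSums M :=
  UniqueSums.of_injective_addHom
    (Module.Free.chooseBasis ℤ M).repr.toAddEquiv.toAddMonoidHom.toAddHom
    (Module.Free.chooseBasis ℤ M).repr.injective inferInstance

instance isDomain_groupRing [Module.Free ℤ M] : IsDomain (AddMonoidAlgebra K M) :=
  NoZeroDivisors.to_isDomain _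

/-- For a Galois extension `K / k` with group `G` and a representation `τ` of `G` on `V = k^d`
(with basis `X₁, …, X_d`), the action of `G` on `K[V] = K[X₁, …, X_d]`, the given one on `K` and
the `k`-linear action `τ` on `V`: `g · X_j = ∑ᵢ τ(g)ᵢⱼ Xᵢ`. -/
noncomputable def linearAction (e : G ≃* (K ≃ₐ[k] K)) {d : ℕ} (τ : G →* GL (Fin d) k) :
    G →* (MvPolynomial (Fin d) K →ₐ[k] MvPolynomial (Fin d) K) where
  toFun g :=
    ((MvPolynomial.aeval (R := K) (fun j : Fin d => ∑ i, MvPolynomial.C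
      (algebraMap k K ((τ g : Matrix (Fin d) (Fin d) k) i j)) *
        MvPolynomial.X i)).restrictScalars k).comp
    (MvPolynomial.mapAlgHom (e g).toAlgHom)
  map_one' := by
    ext
    · simp
    · simp [Matrix.one_apply]
  map_mul' g h := by
    ext x
    · simp
    · simp [Matrix.mul_apply, Finset.sum_mul, Finset.mul_sum, mul_assoc]
      rw [Finset.sum_comm]
      simp only [mul_left_comm]

end Torus

section Properties

variable (G M : Type*) [Group G] [AddCommGroup M] [Module.Free ℤ M] [DistribMulAction G M]

/-- Every algebraic torus with character lattice the `G`-lattice `M` is rational: for every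
Galois extension `K / k` of fields of characteristic zero with group `G`, the `k`-torus
`Spec (K[M]^G)` is `k`-rational. -/
def ToriRational : Prop :=
  ∀ (k K : Type u) [Field k] [CharZero k] [Field K] [Algebra k K] [FiniteDimensional k K]
    [IsGalois k K] (e : G ≃* (K ≃ₐ[k] K)), IsRational k (torusRing M e)

/-- Every algebraic torus with character lattice the `G`-lattice `M` is stably rational. -/
def ToriStablyRational : Prop :=
  ∀ (k K : Type u) [Field k] [CharZero k] [Field K] [Algebra k K] [FiniteDimensional k K]
    [IsGalois k K] (e : G ≃* (K ≃ₐ[k] K)), IsStablyRational k (torusRing M e)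

/-- Every algebraic torus with character lattice the `G`-lattice `M` is linearisable: for every
Galois extension `K / k` of fields of characteristic zero with group `G` there are a
finite-dimensional `k`-linear representation `V` of `G` and a `G`-equivariant isomorphism
`K(M) ≅ K(V)` over `K`, where `G` acts on both fields through its actions on `K` and on `M`,
respectively on `K` and on `V`. -/
def ToriLinearisable : Prop :=
  ∀ (k K : Type u) [Field k] [CharZero k] [Field K] [Algebra k K] [FiniteDimensional k K]
    [IsGalois k K] (e : G ≃* (K ≃ₐ[k] K)),
    ∃ (d : ℕ) (τ : G →* GL (Fin d) k)
      (φ : FractionRing (AddMonoidAlgebra K M) ≃ₐ[K] FractionRing (MvPolynomial (Fin d) K)),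
      ∀ (g : G) (x : FractionRing (AddMonoidAlgebra K M)),
        φ (fracAction (latticeAction M e) g x) = fracAction (linearAction e τ) g (φ x)

/-- The `G`-lattice `M` is hereditarily rational: for every subgroup `H` of `G`, every torus
with character lattice `Res_H^G M` and splitting group `H` is rational. -/
def HereditarilyRational : Prop :=
  ∀ H : Subgroup G, ToriRational.{u} H M

end Properties

section Wreath

variable (G : Type*) [Group G] (n : ℕ)

/-- The wreath product `Gⁿ ⋊ Sₙ`, where `Sₙ` permutes the factors: `(σ g σ⁻¹)ᵢ = g_{σ⁻¹ i}`. -/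
abbrev Wreath : Type _ :=
  (Fin n → G) ⋊[mulAutArrow (G := Equiv.Perm (Fin n)) (A := Fin n) (M := G)] Equiv.Perm (Fin n)

end Wreath

section WreathLattice

variable {G : Type*} [Group G] (n : ℕ) {M : Type*} [AddCommGroup M] [DistribMulAction G M]

instance tensor_free [Module.Free ℤ M] : Module.Free ℤ (M ⊗[ℤ] (Fin n → ℤ)) :=
  Module.Free.of_basis ((Module.Free.chooseBasis ℤ M).tensorProduct (Pi.basisFun ℤ (Fin n)))

/-- The endomorphism `m ⊗ eᵢ ↦ (f i m) ⊗ e_{σ i}` of `M ⊗ Pₙ`. -/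
noncomputable def monomialMap (f : Fin n → (M →+ M)) (σ : Equiv.Perm (Fin n)) :
    M ⊗[ℤ] (Fin n → ℤ) →+ M ⊗[ℤ] (Fin n → ℤ) :=
  ∑ i, (TensorProduct.map (f i).toIntLinearMap
    (LinearMap.single ℤ (fun _ : Fin n => ℤ) (σ i) ∘ₗ LinearMap.proj i)).toAddMonoidHom

theorem monomialMap_apply (f : Fin n → (M →+ M)) (σ : Equiv.Perm (Fin n)) (m : M) (i : Fin n) :
    monomialMap n f σ (m ⊗ₜ Pi.single i 1) = f i m ⊗ₜ Pi.single (σ i) 1 := by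
  rw [monomialMap, AddMonoidHom.finsetSum_apply, Finset.sum_eq_single i]
  · simp
  · intro j _ hj
    simp [Pi.single_eq_of_ne hj]
  · simp

theorem addHom_ext {f f' : M ⊗[ℤ] (Fin n → ℤ) →+ M ⊗[ℤ] (Fin n → ℤ)}
    (h : ∀ (m : M) (i : Fin n), f (m ⊗ₜ Pi.single i 1) = f' (m ⊗ₜ Pi.single i 1)) : f = f' := by
  refine AddMonoidHom.ext fun x => ?_
  induction x using TensorProduct.induction_on with
  | zero => rw [map_zero, map_zero]
  | add x y hx hy => rw [map_add, map_add, hx, hy]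
  | tmul m p =>
    have hp : m ⊗ₜ[ℤ] p = ∑ i, (p i • m) ⊗ₜ[ℤ] (Pi.single i 1 : Fin n → ℤ) := by
      conv_lhs => rw [pi_eq_sum_univ' p, TensorProduct.tmul_sum]
      refine Finset.sum_congr rfl fun i _ => ?_
      rw [TensorProduct.smul_tmul]
    rw [hp, map_sum, map_sum]
    exact Finset.sum_congr rfl fun i _ => h _ i

/-- The element `g σ` of `Gⁿ ⋊ Sₙ` acts on `M ⊗ Pₙ` by `m ⊗ eᵢ ↦ (g_{σ i} m) ⊗ e_{σ i}`. -/
noncomputable def wreathMap (w : Wreath G n) :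
    M ⊗[ℤ] (Fin n → ℤ) →+ M ⊗[ℤ] (Fin n → ℤ) :=
  monomialMap n (fun i => DistribSMul.toAddMonoidHom M (w.left (w.right i))) w.right

theorem wreathMap_apply (w : Wreath G n) (m : M) (i : Fin n) :
    wreathMap n w (m ⊗ₜ Pi.single i 1) = (w.left (w.right i) • m) ⊗ₜ Pi.single (w.right i) 1 :=
  monomialMap_apply n _ _ m i

theorem wreathMap_one : wreathMap (G := G) (M := M) n 1 = AddMonoidHom.id _ := by
  refine addHom_ext n fun m i => ?_
  simp [wreathMap_apply]

theorem wreathMap_mul (v w : Wreath G n) :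
    wreathMap (M := M) n (v * w) = (wreathMap n v).comp (wreathMap n w) := by
  refine addHom_ext n fun m i => ?_
  rw [AddMonoidHom.comp_apply, wreathMap_apply, wreathMap_apply, wreathMap_apply]
  have h : (v * w).left ((v * w).right i) = v.left (v.right (w.right i)) * w.left (w.right i) :=
    congrArg (v.left (v.right (w.right i)) * w.left ·) (v.right.symm_apply_apply (w.right i))
  rw [h, mul_smul]
  rfl

/-- The `Gⁿ ⋊ Sₙ`-lattice `M ⊗ Pₙ`, where `Pₙ = ⨁ ℤ eᵢ` is `Fin n → ℤ` with its standard basis. -/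
noncomputable instance wreathAction : DistribMulAction (Wreath G n) (M ⊗[ℤ] (Fin n → ℤ)) where
  smul w x := wreathMap n w x
  one_smul x := DFunLike.congr_fun (wreathMap_one n) x
  mul_smul v w x := DFunLike.congr_fun (wreathMap_mul n v w) x
  smul_zero w := (wreathMap n w).map_zero
  smul_add w x y := (wreathMap n w).map_add x y

theorem wreathAction_inl (g : Fin n → G) (m : M) (i : Fin n) :
    (SemidirectProduct.inl g : Wreath G n) • (m ⊗ₜ[ℤ] (Pi.single i 1 : Fin n → ℤ)) =
      (g i • m) ⊗ₜ Pi.single i 1 :=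
  wreathMap_apply n _ m i

theorem wreathAction_inr (σ : Equiv.Perm (Fin n)) (m : M) (i : Fin n) :
    (SemidirectProduct.inr σ : Wreath G n) • (m ⊗ₜ[ℤ] (Pi.single i 1 : Fin n → ℤ)) =
      m ⊗ₜ Pi.single (σ i) 1 := by
  refine (wreathMap_apply n _ m i).trans ?_
  simp

end WreathLattice

end WreathTorus

/-! By Galois descent (`isRational_iff_fixedRational`), a torus is rational over `k` exactly when
`K(M)` is generated over `K` by algebraically independent elements invariant under the Galois group
(`FixedRational`). The generators need not be invariant at first: if finitely many generators, no
more than the transcendence degree, have a `K`-span stable under the semilinear action, Speiser's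
lemma replaces them by invariant ones (`fixedRational_of_span_stable`). A family permuted by the
group is enough. The variables of `K(V)` also qualify, so linearisability is equivalent to
rationality (`toriLinearisable_iff`).

Let `Γ` be the Galois group, acting through the wreath product and hence on the indices. The
stabiliser of `i` acts on `M ⊗ eᵢ` through its projection to `G`. The image of this projection is a
subquotient of `Γ`, so it is the Galois group of some `K'/k'` with `K'` inside `K`
(`exists_galois_subquotient`). The hypothesis on `M` over `k'` gives invariant generators of
`K'(M)`. Under `χᵐ ↦ χ^{m ⊗ eᵢ}` they become invariant under the stabiliser, and their translates by
coset representatives form a family permuted by `Γ`. One representative per orbit yields `n · rank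
M` generators of `K(M ⊗ Pₙ)` (`fixedRational_of_hasLocalGenerators`). For the full wreath product
the image is `G` and there is one orbit. For a subgroup the image is only a subgroup of `G`, which
is where heredity enters.

For stable rationality each index carries a block of `s` extra variables. The blocks should be
permuted along with the indices, but the adjoined variables are invariant. An invertible matrix over
`K` whose rows are permuted by `Γ` converts one kind into the other (`exists_matrix_permuted`). -/

namespace WreathTorus

/-! ### Speiser's lemma and invariant generators. -/

section Descent

variable {k K G : Type*} [Field k] [Field K] [Algebra k K] [Group G]

/-- Speiser's lemma: a vector space with a semilinear action of a finite group acting faithfully on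
the field of scalars is spanned by its invariant vectors. -/
theorem span_fixed_eq_top [Finite G] (e : G ≃* (K ≃ₐ[k] K)) {V : Type*} [AddCommGroup V]
    [Module K V] (s : G → V →+ V) (s_one : ∀ v, s 1 v = v)
    (s_mul : ∀ g h v, s (g * h) v = s g (s h v))
    (s_smul : ∀ g (a : K) v, s g (a • v) = e g a • s g v) :
    Submodule.span K {v | ∀ g, s g v = v} = ⊤ := by
  classical
  cases nonempty_fintype G
  by_contra h
  obtain ⟨f, hf, hle⟩ := Submodule.exists_le_ker_of_lt_top _ (lt_top_iff_ne_top.2 h)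
  apply hf
  ext v
  -- The trace of `a • v` is invariant, so `f` kills it. As `a` varies this is a linear relation
  -- among the distinct characters `e g`, and Dedekind's independence forces each coefficient to
  -- vanish; the one at `g = 1` is `f v`.
  have hsum : ∀ a : K, ∑ g, f (s g v) * e g a = 0 := by
    intro a
    have hmem : ∑ g, s g (a • v) ∈ {v | ∀ g, s g v = v} := by
      intro g
      rw [map_sum]
      simp_rw [← s_mul]
      exact Fintype.sum_equiv (Equiv.mulLeft g) _ _ fun _ => rfl
    have := hle (Submodule.subset_span hmem)
    rw [LinearMap.mem_ker, map_sum] at this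
    rw [← this]
    refine Finset.sum_congr rfl fun g _ => ?_
    rw [s_smul, map_smul, smul_eq_mul, mul_comm]
  have hli : LinearIndependent K (fun g : G => ((e g : K →* K) : K → K)) :=
    (linearIndependent_monoidHom K K).comp (fun g => (e g : K →* K)) fun g h hgh =>
      e.injective (AlgEquiv.ext fun x => DFunLike.congr_fun hgh x)
  have := Fintype.linearIndependent_iff.1 hli (fun g => f (s g v)) (by
    ext a
    simpa using hsum a) 1
  simpa [s_one] using this

variable {Ω : Type*} [Field Ω] [Algebra k Ω] [Algebra K Ω]

variable (K) in
/-- The extension `Ω / K` is generated by `d` algebraically independent elements that are fixed by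
the group `G` of automorphisms of `Ω`. -/
def FixedRational (d : ℕ) (a : G →* (Ω ≃ₐ[k] Ω)) : Prop :=
  ∃ z : Fin d → Ω, (∀ g i, a g (z i) = z i) ∧ AlgebraicIndependent K z ∧
    IntermediateField.adjoin K (Set.range z) = ⊤

theorem isAlgebraic_algebraAdjoin_of_adjoin_eq_top {t : Set Ω}
    (h : IntermediateField.adjoin K t = ⊤) : Algebra.IsAlgebraic (Algebra.adjoin K t) Ω := by
  rw [← IntermediateField.isAlgebraic_adjoin_iff_top, h, Algebra.isAlgebraic_iff_isIntegral]
  exact Algebra.isIntegral_of_surjective IntermediateField.topEquiv.surjective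

theorem trdeg_le_of_adjoin_eq_top {ι : Type*} [Finite ι] {z : ι → Ω}
    (h : IntermediateField.adjoin K (Set.range z) = ⊤) : Algebra.trdeg K Ω ≤ Nat.card ι := by
  have := isAlgebraic_algebraAdjoin_of_adjoin_eq_top h
  refine (Algebra.IsAlgebraic.trdeg_le_cardinalMk K (Set.range z)).trans ?_
  have := Fintype.ofFinite ι
  simpa using Cardinal.mk_range_le_lift (f := z)

/-- A generating family contains a transcendence basis, so one with at most as many members as the
transcendence degree has nothing to discard. -/
theorem algebraicIndependent_of_adjoin_eq_top {d : ℕ} {z : Fin d → Ω}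
    (h : IntermediateField.adjoin K (Set.range z) = ⊤) (hd : (d : Cardinal) ≤ Algebra.trdeg K Ω) :
    AlgebraicIndependent K z := by
  have := isAlgebraic_algebraAdjoin_of_adjoin_eq_top h
  exact (Algebra.IsAlgebraic.isTranscendenceBasis_of_lift_le_trdeg_of_finite K z (by simpa)).1

omit [Algebra k K] in
theorem FixedRational.trdeg_eq {d : ℕ} {a : G →* (Ω ≃ₐ[k] Ω)} (h : FixedRational K d a) :
    Algebra.trdeg K Ω = d := by
  obtain ⟨z, -, hz, hgen⟩ := h
  refine ((trdeg_le_of_adjoin_eq_top hgen).trans_eq (by simp)).antisymm ?_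
  simpa using hz.lift_cardinalMk_le_trdeg

/-- If `Ω / K` is generated by a finite family, no larger than its transcendence degree, whose
`K`-span is stable under a semilinear action of `G`, then it has free invariant generators. -/
theorem fixedRational_of_span_stable [Finite G] (e : G ≃* (K ≃ₐ[k] K)) (a : G →* (Ω ≃ₐ[k] Ω))
    (ha : ∀ g x, a g (algebraMap K Ω x) = algebraMap K Ω (e g x)) {ι : Type*} [Finite ι]
    (v : ι → Ω) (hv : ∀ g i, a g (v i) ∈ Submodule.span K (Set.range v))
    (hgen : IntermediateField.adjoin K (Set.range v) = ⊤) {d : ℕ} (hcard : Nat.card ι ≤ d)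
    (hd : (d : Cardinal) ≤ Algebra.trdeg K Ω) : FixedRational K d a := by
  classical
  set V := Submodule.span K (Set.range v) with hV
  have hsmul : ∀ g (c : K) (x : Ω), a g (c • x) = e g c • a g x := fun g c x => by
    rw [Algebra.smul_def, map_mul, ha, ← Algebra.smul_def]
  have hstable : ∀ g, ∀ x ∈ V, a g x ∈ V := by
    intro g x hx
    induction hx using Submodule.span_induction with
    | mem x hx => obtain ⟨i, rfl⟩ := hx; exact hv g i
    | zero => rw [map_zero]; exact V.zero_mem
    | add x y _ _ hx hy => rw [map_add]; exact V.add_mem hx hy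
    | smul c x _ hx => rw [hsmul]; exact V.smul_mem _ hx
  have hspan := span_fixed_eq_top (V := V) e
    (fun g => { toFun := fun x => ⟨a g x, hstable g x x.2⟩
                map_zero' := by simp
                map_add' := fun x y => by simp })
    (fun x => by simp) (fun g h x => by simp) (fun g c x => Subtype.ext (hsmul g c x))
  set s : Set Ω := {x | x ∈ V ∧ ∀ g, a g x = x} with hs
  have hsV : Submodule.span K s = V := by
    refine le_antisymm (Submodule.span_le.2 fun x hx => hx.1) ?_
    have := congrArg (Submodule.map V.subtype) hspan
    rw [Submodule.map_top, Submodule.range_subtype, Submodule.map_span] at this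
    refine this.symm.le.trans (Submodule.span_mono ?_)
    rintro _ ⟨x, hx, rfl⟩
    exact ⟨x.2, fun g => congrArg Subtype.val (hx g)⟩
  have : FiniteDimensional K (Submodule.span K s) := by
    rw [hsV]; exact FiniteDimensional.span_of_finite K (Set.finite_range v)
  -- A basis of `V` selected from the invariant vectors themselves.
  obtain ⟨f, hf, hfs, -⟩ := Submodule.exists_fun_fin_finrank_span_eq K s
  have hfgen : IntermediateField.adjoin K (Set.range f) = ⊤ := by
    rw [eq_top_iff, ← hgen, IntermediateField.adjoin_le_iff]
    rintro _ ⟨i, rfl⟩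
    have hi : v i ∈ Submodule.span K (Set.range f) := by
      rw [hfs, hsV]
      exact Submodule.subset_span ⟨i, rfl⟩
    exact Submodule.span_le (p := (IntermediateField.adjoin K (Set.range f)).toSubalgebra.toSubmodule)
      |>.2 (IntermediateField.subset_adjoin K _) hi
  -- Squeeze: `finrank V ≤ card ι ≤ d ≤ trdeg ≤ finrank V`, the last because the basis `f` generates
  -- `Ω`.
  have hm : Module.finrank K (Submodule.span K s) = d := by
    apply le_antisymm
    · rw [hsV]
      cases nonempty_fintype ι
      exact (finrank_range_le_card v).trans (by rwa [← Nat.card_eq_fintype_card])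
    · have := hd.trans (trdeg_le_of_adjoin_eq_top hfgen)
      rwa [Nat.card_fin, Nat.cast_le] at this
  rw [← hm] at hd ⊢
  exact ⟨f, fun g i => (hf i).2 g, algebraicIndependent_of_adjoin_eq_top hfgen hd, hfgen⟩

end Descent

/-! ### Galois descent of rationality. -/

section Invariants

variable {k K G A R : Type*} [Field k] [Field K] [Algebra k K] [Group G] [Finite G]
  [CommRing A] [IsDomain A] [Algebra k A] [Algebra K A] [IsScalarTower k K A]
  [CommRing R] [IsDomain R] [Algebra k R]

omit [Finite G] [IsDomain A] in
theorem action_injective (act : G →* (A →ₐ[k] A)) (g : G) : Function.Injective (act g) := by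
  refine Function.LeftInverse.injective (g := act g⁻¹) fun x => ?_
  rw [← AlgHom.mul_apply, ← map_mul, inv_mul_cancel, map_one, AlgHom.one_apply]

/-- The embedding of fraction fields induced by an injective homomorphism of domains. -/
noncomputable def fracMap (ι : R →ₐ[k] A) (hι : Function.Injective ι) :
    FractionRing R →ₐ[k] FractionRing A :=
  IsFractionRing.liftAlgHom (g := (IsScalarTower.toAlgHom k A (FractionRing A)).comp ι)
    ((IsFractionRing.injective A (FractionRing A)).comp hι)

theorem fracMap_algebraMap (ι : R →ₐ[k] A) (hι : Function.Injective ι) (r : R) :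
    fracMap ι hι (algebraMap R _ r) = algebraMap A _ (ι r) :=
  IsFractionRing.lift_algebraMap
    ((IsFractionRing.injective A (FractionRing A)).comp hι :
      Function.Injective ((IsScalarTower.toAlgHom k A (FractionRing A)).comp ι).toRingHom) r

/-- Multiplying numerator and denominator of an invariant fraction by the other conjugates of the
denominator makes the denominator a norm. The denominator is then invariant, hence so is the
numerator. -/
theorem mem_range_fracMap (act : G →* (A →ₐ[k] A)) (ι : R →ₐ[k] A) (hι : Function.Injective ι)
    (hrange : ∀ x, (∀ g, act g x = x) ↔ x ∈ Set.range ι) (f : FractionRing A) :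
    (∀ g, fracAction act g f = f) ↔ f ∈ Set.range (fracMap ι hι) := by
  classical
  cases nonempty_fintype G
  have hinj := IsFractionRing.injective A (FractionRing A)
  constructor
  · intro hf
    obtain ⟨x, y, hy, rfl⟩ := IsFractionRing.div_surjective (A := A) f
    have hy0 : y ≠ 0 := nonZeroDivisors.ne_zero hy
    set N := ∏ g, act g y with hN
    have hN0 : N ≠ 0 := Finset.prod_ne_zero_iff.2 fun g _ =>
      (map_ne_zero_iff _ (action_injective act g)).2 hy0
    have hNfix : ∀ g, act g N = N := by
      intro g
      rw [hN, map_prod]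
      exact Fintype.prod_equiv (Equiv.mulLeft g) _ _ fun h => by simp
    set c := ∏ g ∈ Finset.univ.erase (1 : G), act g y with hc
    have hNc : N = y * c := by
      rw [hN, ← Finset.mul_prod_erase _ _ (Finset.mem_univ (1 : G)), map_one, AlgHom.one_apply]
    set f := algebraMap A (FractionRing A) x / algebraMap A _ y with hfdef
    have hfN : f * algebraMap A _ N = algebraMap A _ (x * c) := by
      have : algebraMap A (FractionRing A) y ≠ 0 := (map_ne_zero_iff _ hinj).2 hy0
      rw [hNc, map_mul, map_mul, hfdef]
      field_simp
    have hpfix : ∀ g, act g (x * c) = x * c := by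
      intro g
      apply hinj
      rw [← fracAction_algebraMap, ← hfN, map_mul, hf g, fracAction_algebraMap, hNfix]
    obtain ⟨p, hp⟩ := (hrange _).1 hpfix
    obtain ⟨q, hq⟩ := (hrange _).1 hNfix
    refine ⟨algebraMap R _ p / algebraMap R _ q, ?_⟩
    rw [map_div₀, fracMap_algebraMap, fracMap_algebraMap, hp, hq, ← hfN,
      mul_div_cancel_right₀ _ ((map_ne_zero_iff _ hinj).2 hN0)]
  · rintro ⟨r, rfl⟩ g
    obtain ⟨x, y, hy, rfl⟩ := IsFractionRing.div_surjective (A := R) r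
    rw [map_div₀, map_div₀, fracMap_algebraMap, fracMap_algebraMap, fracAction_algebraMap,
      fracAction_algebraMap, (hrange _).2 ⟨x, rfl⟩, (hrange _).2 ⟨y, rfl⟩]

omit [Finite G] [IsScalarTower k K A] in
theorem fracAction_algebraMap_field {e : G ≃* (K ≃ₐ[k] K)} {act : G →* (A →ₐ[k] A)}
    (hact : ∀ g x, act g (algebraMap K A x) = algebraMap K A (e g x)) (g : G) (x : K) :
    fracAction act g (algebraMap K (FractionRing A) x) =
      algebraMap K (FractionRing A) (e g x) := by
  rw [IsScalarTower.algebraMap_apply K A (FractionRing A), fracAction_algebraMap, hact,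
    ← IsScalarTower.algebraMap_apply]

/-- If `K(z) = F` with `z` invariant, then the invariants of `F` lie in `k(z)`. -/
theorem fixed_mem_adjoin [CharZero k] [FiniteDimensional k K] {F : Type*} [Field F] [Algebra k F]
    [Algebra K F] [IsScalarTower k K F] [IsGalois k K] (e : G ≃* (K ≃ₐ[k] K))
    (a : G →* (F ≃ₐ[k] F)) (ha : ∀ g x, a g (algebraMap K F x) = algebraMap K F (e g x))
    {t : Set F} (ht : ∀ g, ∀ x ∈ t, a g x = x) (hgen : IntermediateField.adjoin K t = ⊤) {x : F}
    (hx : ∀ g, a g x = x) : x ∈ IntermediateField.adjoin k t := by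
  classical
  cases nonempty_fintype G
  set E := IntermediateField.adjoin k t with hE
  set C := (IsScalarTower.toAlgHom k K F).fieldRange with hC
  have : Algebra.IsAlgebraic k C :=
    (AlgEquiv.ofInjectiveField (IsScalarTower.toAlgHom k K F)).isAlgebraic
  have hEfix : ∀ g, ∀ y ∈ E, a g y = y := by
    intro g y hy
    induction hy using IntermediateField.adjoin_induction with
    | mem y hy => exact ht g y hy
    | algebraMap c => exact (a g).commutes c
    | add y z _ _ hy hz => rw [map_add, hy, hz]
    | inv y _ hy => rw [map_inv₀, hy]
    | mul y z _ _ hy hz => rw [map_mul, hy, hz]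
  have htop : E ⊔ C = ⊤ := by
    rw [eq_top_iff]
    intro y _
    have hy : y ∈ IntermediateField.adjoin K t := hgen ▸ trivial
    induction hy using IntermediateField.adjoin_induction with
    | mem y hy => exact (le_sup_left : E ≤ E ⊔ C) (IntermediateField.subset_adjoin k t hy)
    | algebraMap c => exact (le_sup_right : C ≤ E ⊔ C) ⟨c, rfl⟩
    | add y z _ _ hy hz => exact add_mem (hy trivial) (hz trivial)
    | inv y _ hy => exact inv_mem (hy trivial)
    | mul y z _ _ hy hz => exact mul_mem (hy trivial) (hz trivial)
  -- Since `C` is algebraic over `k`, the compositum `E ⊔ C = F` consists of sums of products `b *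
  -- c`. The sum over the group is `E`-linear and acts on `C` as the trace of `K/k`, so it maps `F`
  -- into `E`.
  have hsum : ∀ y : F, ∑ g, a g y ∈ E := by
    intro y
    have hy : y ∈ Subalgebra.toSubmodule E.toSubalgebra * Subalgebra.toSubmodule C.toSubalgebra := by
      rw [Subalgebra.mul_toSubmodule, ← IntermediateField.sup_toSubalgebra_of_isAlgebraic_right,
        htop]
      trivial
    induction hy using Submodule.mul_induction_on' with
    | mem_mul_mem b hb c hc =>
      obtain ⟨c, rfl⟩ := hc
      have htr : ∑ g, a g (algebraMap K F c) = algebraMap k F (Algebra.trace k K c) := by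
        rw [IsScalarTower.algebraMap_apply k K F, trace_eq_sum_automorphisms, map_sum]
        exact Fintype.sum_equiv e.toEquiv _ _ fun g => ha g c
      have : ∑ g, a g (b * algebraMap K F c) = b * algebraMap k F (Algebra.trace k K c) := by
        rw [← htr, Finset.mul_sum]
        exact Finset.sum_congr rfl fun g _ => by rw [map_mul, hEfix g b hb]
      exact this ▸ mul_mem hb (E.algebraMap_mem _)
    | add y _ z _ hy hz =>
      simp only [map_add, Finset.sum_add_distrib]
      exact add_mem hy hz
  -- Characteristic zero: an invariant `x` is recovered from its trace `|G| x`.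
  have hcard : (Fintype.card G : F) ≠ 0 := by
    have : CharZero F := charZero_of_injective_algebraMap (algebraMap k F).injective
    exact_mod_cast Fintype.card_ne_zero
  have hxs := hsum x
  simp only [hx, Finset.sum_const, Finset.card_univ, nsmul_eq_mul] at hxs
  have : x = (Fintype.card G : F)⁻¹ * (Fintype.card G * x) := by field_simp
  rw [this]
  exact mul_mem (inv_mem (natCast_mem E _)) hxs

/-- Galois descent of rationality: `Frac (A^G)` is rational over `k` if and only if `Frac A` has
free invariant generators over `K`. -/
theorem isRational_iff_fixedRational [CharZero k] [FiniteDimensional k K] [IsGalois k K]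
    (e : G ≃* (K ≃ₐ[k] K))
    (act : G →* (A →ₐ[k] A)) (hact : ∀ g x, act g (algebraMap K A x) = algebraMap K A (e g x))
    (ι : R →ₐ[k] A) (hι : Function.Injective ι)
    (hrange : ∀ x, (∀ g, act g x = x) ↔ x ∈ Set.range ι) :
    IsRational k R ↔ ∃ d, FixedRational K d (fracAction act) := by
  have ha := fracAction_algebraMap_field hact
  constructor
  · rintro ⟨d, z, hz, hgen⟩
    -- Independence over `k` persists over `K` because `K/k` is algebraic.
    refine ⟨d, fun i => fracMap ι hι (z i), fun g i =>
      (mem_range_fracMap act ι hι hrange _).2 ⟨_, rfl⟩ g,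
      (hz.map' (f := fracMap ι hι) (fracMap ι hι).injective).extendScalars K, ?_⟩
    set E := IntermediateField.adjoin K (Set.range fun i => fracMap ι hι (z i)) with hE
    have hmem : ∀ x, fracMap ι hι x ∈ E := by
      intro x
      have hx : x ∈ IntermediateField.adjoin k (Set.range z) := hgen ▸ trivial
      induction hx using IntermediateField.adjoin_induction with
      | mem y hy =>
        obtain ⟨i, rfl⟩ := hy
        exact IntermediateField.subset_adjoin K _ ⟨i, rfl⟩
      | algebraMap c =>
        rw [AlgHom.commutes, IsScalarTower.algebraMap_apply k K]
        exact E.algebraMap_mem _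
      | add y z _ _ hy hz => rw [map_add]; exact add_mem hy hz
      | inv y _ hy => rw [map_inv₀]; exact inv_mem hy
      | mul y z _ _ hy hz => rw [map_mul]; exact mul_mem hy hz
    rw [eq_top_iff]
    intro f _
    -- Speiser's lemma on the whole of `Frac A`: it is spanned over `K` by invariants, and these
    -- come from `Frac R = k(z)`.
    have hspan := span_fixed_eq_top (V := FractionRing A) e
      (fun g => (fracAction act g : FractionRing A →+ FractionRing A)) (fun v => by simp)
      (fun g h v => by simp) fun g c v => by
        simp only [AddMonoidHom.coe_coe, Algebra.smul_def, map_mul, ha]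
    have hf : f ∈ Submodule.span K {v | ∀ g, fracAction act g v = v} := by
      refine hspan.symm ▸ trivial
    refine Submodule.span_le (p := Subalgebra.toSubmodule E.toSubalgebra) |>.2 ?_ hf
    intro v hv
    obtain ⟨x, rfl⟩ := (mem_range_fracMap act ι hι hrange v).1 hv
    exact hmem x
  · rintro ⟨d, z, hfix, hz, hgen⟩
    choose y hy using fun i => (mem_range_fracMap act ι hι hrange (z i)).1 fun g => hfix g i
    obtain rfl : (fun i => fracMap ι hι (y i)) = z := funext hy
    refine ⟨d, y, (hz.restrictScalars (algebraMap k K).injective).of_comp (fracMap ι hι), ?_⟩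
    rw [eq_top_iff]
    intro x _
    have hx := fixed_mem_adjoin e (fracAction act) ha
      (by rintro g _ ⟨i, rfl⟩; exact hfix g i) hgen
      ((mem_range_fracMap act ι hι hrange (fracMap ι hι x)).2 ⟨x, rfl⟩)
    have hr : (Set.range fun i => fracMap ι hι (y i)) = fracMap ι hι '' Set.range y := by
      rw [← Set.range_comp]; rfl
    rw [hr, ← IntermediateField.adjoin_map] at hx
    obtain ⟨x', hx', h⟩ := hx
    exact (fracMap ι hι).injective h ▸ hx'

end Invariants

/-! ### Tori times affine spaces. -/

section Polynomial

variable {k K G M : Type*} [Field k] [Field K] [Algebra k K] [Group G] [AddCommGroup M]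
  [DistribMulAction G M]

variable (M) in
/-- The action of `G` on `K[M][x_i : i ∈ σ]` that fixes the variables. -/
noncomputable def polyAction (σ : Type*) (e : G ≃* (K ≃ₐ[k] K)) :
    G →* (MvPolynomial σ (AddMonoidAlgebra K M) →ₐ[k] MvPolynomial σ (AddMonoidAlgebra K M)) where
  toFun g := MvPolynomial.mapAlgHom (latticeAction M e g)
  map_one' := by rw [map_one]; exact MvPolynomial.mapAlgHom_id
  map_mul' g h := AlgHom.ext fun p => by
    change MvPolynomial.map _ p = MvPolynomial.map _ (MvPolynomial.map _ p)
    rw [MvPolynomial.map_map, map_mul]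
    rfl

variable {σ : Type*}

theorem polyAction_C (e : G ≃* (K ≃ₐ[k] K)) (g : G) (x : AddMonoidAlgebra K M) :
    polyAction M σ e g (MvPolynomial.C x) = MvPolynomial.C (latticeAction M e g x) := by
  exact MvPolynomial.map_C _ _

theorem polyAction_X (e : G ≃* (K ≃ₐ[k] K)) (g : G) (i : σ) :
    polyAction M σ e g (MvPolynomial.X i) = MvPolynomial.X i := by
  exact MvPolynomial.map_X _ _

theorem latticeAction_algebraMap (e : G ≃* (K ≃ₐ[k] K)) (g : G) (x : K) :
    latticeAction M e g (algebraMap K _ x) = algebraMap K _ (e g x) := by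
  rw [AddMonoidAlgebra.coe_algebraMap]
  simp [latticeAction_single]

theorem polyAction_algebraMap (e : G ≃* (K ≃ₐ[k] K)) (g : G) (x : K) :
    polyAction M σ e g (algebraMap K _ x) = algebraMap K _ (e g x) := by
  rw [MvPolynomial.algebraMap_apply, polyAction_C, latticeAction_algebraMap,
    ← MvPolynomial.algebraMap_apply]

theorem coeff_polyAction (e : G ≃* (K ≃ₐ[k] K)) (g : G)
    (p : MvPolynomial σ (AddMonoidAlgebra K M)) (m : σ →₀ ℕ) :
    (polyAction M σ e g p).coeff m = latticeAction M e g (p.coeff m) := by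
  exact MvPolynomial.coeff_map _ _ _

variable [Module.Free ℤ M] [Finite G] [CharZero k] [FiniteDimensional k K] [IsGalois k K]

theorem isRational_torusRing_iff (e : G ≃* (K ≃ₐ[k] K)) :
    IsRational k (torusRing M e) ↔ ∃ d, FixedRational K d (fracAction (latticeAction M e)) :=
  isRational_iff_fixedRational e _ (latticeAction_algebraMap e) (torusRing M e).val
    Subtype.val_injective fun x => ⟨fun h => ⟨⟨x, h⟩, rfl⟩, by rintro ⟨y, rfl⟩; exact y.2⟩

/-- With no variables, rationality becomes a case of the statement with variables, so plain and
stable rationality share one argument. -/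
theorem isRational_torusRing_iff_of_isEmpty [IsEmpty σ] (e : G ≃* (K ≃ₐ[k] K)) :
    IsRational k (torusRing M e) ↔ ∃ d, FixedRational K d (fracAction (polyAction M σ e)) := by
  refine isRational_iff_fixedRational e _ (polyAction_algebraMap e)
    ((IsScalarTower.toAlgHom k (AddMonoidAlgebra K M) (MvPolynomial σ (AddMonoidAlgebra K M))).comp
      (torusRing M e).val)
    ((MvPolynomial.C_injective σ _).comp Subtype.val_injective) fun x => ?_
  obtain ⟨x, rfl⟩ := MvPolynomial.C_surjective σ x
  simp only [polyAction_C, MvPolynomial.C_inj]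
  constructor
  · intro h
    exact ⟨⟨x, h⟩, rfl⟩
  · rintro ⟨y, hy⟩
    obtain rfl : (y : AddMonoidAlgebra K M) = x := MvPolynomial.C_injective σ _ hy
    exact y.2

/-- Invariance of a polynomial is tested on coefficients. The reindexing is needed because the
variables for `M ⊗ Pₙ` arise indexed by pairs. -/
theorem isRational_mvPolynomial_torusRing_iff {σ' : Type*} (f : σ' ≃ σ) (e : G ≃* (K ≃ₐ[k] K)) :
    IsRational k (MvPolynomial σ' (torusRing M e)) ↔
      ∃ d, FixedRational K d (fracAction (polyAction M σ e)) := by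
  refine isRational_iff_fixedRational e _ (polyAction_algebraMap e)
    ((MvPolynomial.mapAlgHom (torusRing M e).val).comp
      ((MvPolynomial.renameEquiv (torusRing M e) f).toAlgHom.restrictScalars k))
    ((MvPolynomial.map_injective _ Subtype.val_injective).comp
      (MvPolynomial.renameEquiv (torusRing M e) f).injective) fun p => ?_
  have hrange : Set.range ((MvPolynomial.mapAlgHom (torusRing M e).val).comp
      ((MvPolynomial.renameEquiv (torusRing M e) f).toAlgHom.restrictScalars k)) =
      Set.range (MvPolynomial.map (σ := σ) (torusRing M e).val.toRingHom) :=
    (MvPolynomial.renameEquiv (torusRing M e) f).surjective.range_comp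
      (MvPolynomial.map (σ := σ) (torusRing M e).val.toRingHom)
  rw [hrange, MvPolynomial.mem_range_map_iff_coeffs_subset]
  constructor
  · intro h x hx
    obtain ⟨m, -, rfl⟩ := MvPolynomial.mem_coeffs_iff.1 hx
    exact ⟨⟨p.coeff m, fun g => by rw [← coeff_polyAction, h]⟩, rfl⟩
  · intro h g
    ext1 m
    rw [coeff_polyAction]
    by_cases hm : m ∈ p.support
    · obtain ⟨y, hy⟩ := h (MvPolynomial.mem_coeffs_iff.2 ⟨m, hm, rfl⟩)
      rw [← hy]
      exact y.2 g
    · rw [MvPolynomial.notMem_support_iff.1 hm, map_zero]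

end Polynomial

/-! ### Generators and transcendence degree of `K(M)(x)`. -/

section TranscendenceDegree

variable {K M σ : Type*} [Field K] [AddCommGroup M] [Module.Free ℤ M]

/-- An intermediate field of `Frac K[M][x] / K` that contains the variables and generators of the
group of characters is the whole field. -/
theorem eq_top_of_single_mem
    (E : IntermediateField K (FractionRing (MvPolynomial σ (AddMonoidAlgebra K M))))
    {S : Set M} (hS : Submodule.span ℤ S = ⊤)
    (hM : ∀ m ∈ S, algebraMap _ _ (MvPolynomial.C (AddMonoidAlgebra.single m 1) :
      MvPolynomial σ (AddMonoidAlgebra K M)) ∈ E)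
    (hX : ∀ i, algebraMap _ _ (MvPolynomial.X i : MvPolynomial σ (AddMonoidAlgebra K M)) ∈ E) :
    E = ⊤ := by
  set χ : M → FractionRing (MvPolynomial σ (AddMonoidAlgebra K M)) := fun m =>
    algebraMap _ _ (MvPolynomial.C (AddMonoidAlgebra.single m 1) :
      MvPolynomial σ (AddMonoidAlgebra K M)) with hχ
  have χ_zero : χ 0 = 1 := by
    simp only [hχ, ← AddMonoidAlgebra.one_def, map_one]
  have χ_add : ∀ m m', χ (m + m') = χ m * χ m' := by
    intro m m'
    simp only [hχ, ← map_mul, AddMonoidAlgebra.single_mul_single, one_mul]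
  let H : AddSubgroup M :=
    { carrier := {m | χ m ∈ E}
      zero_mem' := by simp [χ_zero]
      add_mem' := fun {m m'} hm hm' => by
        rw [Set.mem_ofPred_eq, χ_add]
        exact mul_mem hm hm'
      neg_mem' := fun {m} hm => by
        have : χ (-m) = (χ m)⁻¹ := eq_inv_of_mul_eq_one_left (by
          rw [← χ_add, neg_add_cancel, χ_zero])
        rw [Set.mem_ofPred_eq, this]
        exact inv_mem hm }
  replace hM : ∀ m, χ m ∈ E := fun m =>
    Submodule.span_le (p := AddSubgroup.toIntSubmodule H).2 hM (hS ▸ trivial : m ∈ _)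
  rw [eq_top_iff]
  intro x _
  obtain ⟨p, q, -, rfl⟩ :=
    IsFractionRing.div_surjective (A := MvPolynomial σ (AddMonoidAlgebra K M)) x
  have key : ∀ p : MvPolynomial σ (AddMonoidAlgebra K M), algebraMap _ _ p ∈ E := by
    intro p
    induction p using MvPolynomial.induction_on with
    | C a =>
      induction a using AddMonoidAlgebra.induction_linear with
      | zero => simp
      | add a b ha hb => rw [map_add, map_add]; exact add_mem ha hb
      | single m c =>
        have : (AddMonoidAlgebra.single m c : AddMonoidAlgebra K M) =
            algebraMap K _ c * AddMonoidAlgebra.single m 1 := by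
          simp [AddMonoidAlgebra.coe_algebraMap, AddMonoidAlgebra.single_mul_single]
        rw [this, map_mul, map_mul]
        refine mul_mem ?_ (hM m)
        rw [← MvPolynomial.algebraMap_apply, ← IsScalarTower.algebraMap_apply]
        exact E.algebraMap_mem c
    | add p q hp hq => rw [map_add]; exact add_mem hp hq
    | mul_X p i hp => rw [map_mul]; exact mul_mem hp (hX i)
  exact div_mem (key p) (key q)

-- A basis embeds `ℕ^ι` in `M`, so evaluation at the basis characters is the map of monoid algebras
-- induced by this embedding.
omit [Module.Free ℤ M] in
theorem algebraicIndependent_single {ι : Type*} (b : Module.Basis ι ℤ M) :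
    AlgebraicIndependent K fun i => (AddMonoidAlgebra.single (b i) 1 : AddMonoidAlgebra K M) := by
  classical
  set φ : (ι →₀ ℕ) →+ M := b.repr.symm.toAddEquiv.toAddMonoidHom.comp
    (Finsupp.mapRange.addMonoidHom (Nat.castAddMonoidHom ℤ)) with hφ
  have hinj : Function.Injective φ :=
    b.repr.symm.injective.comp (Finsupp.mapRange_injective _ rfl Nat.cast_injective)
  have h : (MvPolynomial.aeval fun i => (AddMonoidAlgebra.single (b i) 1 : AddMonoidAlgebra K M)) =
      (AddMonoidAlgebra.mapDomainAlgHom K K φ : MvPolynomial ι K →ₐ[K] AddMonoidAlgebra K M) := by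
    ext i : 1
    rw [MvPolynomial.aeval_X]
    change _ = AddMonoidAlgebra.mapDomain φ (AddMonoidAlgebra.single (Finsupp.single i 1) 1)
    rw [AddMonoidAlgebra.mapDomain_single]
    congr 1
    simp [hφ]
  rw [algebraicIndependent_iff_injective_aeval, h]
  exact AddMonoidAlgebra.mapDomain_injective hinj

/-- The characters of a basis of `M` together with the variables are independent and generate. -/
theorem trdeg_fractionRing [Module.Finite ℤ M] [Finite σ] :
    Algebra.trdeg K (FractionRing (MvPolynomial σ (AddMonoidAlgebra K M))) =
      ((Module.finrank ℤ M + Nat.card σ : ℕ) : Cardinal) := by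
  set b := Module.finBasis ℤ M
  have hind := ((algebraicIndependent_single (K := K) b).sumElim_comp
    (MvPolynomial.algebraicIndependent_X σ (AddMonoidAlgebra K M))).map'
      (f := IsScalarTower.toAlgHom K (MvPolynomial σ (AddMonoidAlgebra K M))
        (FractionRing (MvPolynomial σ (AddMonoidAlgebra K M))))
      (IsFractionRing.injective (MvPolynomial σ (AddMonoidAlgebra K M)) _)
  have hgen : IntermediateField.adjoin K (Set.range (
      IsScalarTower.toAlgHom K (MvPolynomial σ (AddMonoidAlgebra K M))
        (FractionRing (MvPolynomial σ (AddMonoidAlgebra K M))) ∘ Sum.elim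
        MvPolynomial.X (algebraMap (AddMonoidAlgebra K M) _ ∘
          fun i => AddMonoidAlgebra.single (b i) 1))) = ⊤ := by
    refine eq_top_of_single_mem _ b.span_eq ?_ fun i => ?_
    · rintro _ ⟨i, rfl⟩
      exact IntermediateField.subset_adjoin K _ ⟨Sum.inr i, by simp [MvPolynomial.algebraMap_eq]⟩
    · exact IntermediateField.subset_adjoin K _ ⟨Sum.inl i, by simp⟩
  have hcard : Nat.card (σ ⊕ Fin (Module.finrank ℤ M)) = Module.finrank ℤ M + Nat.card σ := by
    rw [Nat.card_sum, Nat.card_fin, add_comm]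
  rw [← hcard]
  refine (trdeg_le_of_adjoin_eq_top hgen).antisymm ?_
  have h := hind.lift_cardinalMk_le_trdeg
  rwa [← Nat.cast_card, Cardinal.lift_natCast, Cardinal.nat_le_lift_iff] at h

end TranscendenceDegree

/-! ### Linearisability and rationality. -/

section Linearisable

variable {k K G : Type*} [Field k] [Field K] [Algebra k K] [Group G]

omit [Algebra k K] in
theorem FixedRational.of_equiv {Ω Ω' : Type*} [Field Ω] [Algebra k Ω] [Algebra K Ω] [Field Ω']
    [Algebra k Ω'] [Algebra K Ω'] {a : G →* (Ω ≃ₐ[k] Ω)} {a' : G →* (Ω' ≃ₐ[k] Ω')} {d : ℕ}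
    (φ : Ω ≃ₐ[K] Ω') (hφ : ∀ g x, φ (a g x) = a' g (φ x)) (h : FixedRational K d a) :
    FixedRational K d a' := by
  obtain ⟨z, hfix, hz, hgen⟩ := h
  refine ⟨fun i => φ (z i), fun g i => by rw [← hφ, hfix],
    hz.map' (f := φ.toAlgHom) φ.injective, ?_⟩
  have hr : (Set.range fun i => φ (z i)) = φ.toAlgHom '' Set.range z := by
    rw [← Set.range_comp]; rfl
  rw [hr, ← IntermediateField.adjoin_map, hgen, ← AlgHom.fieldRange_eq_map]
  exact AlgHom.fieldRange_eq_top.2 φ.surjective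

theorem adjoin_X_eq_top (d : ℕ) : IntermediateField.adjoin K (Set.range fun i : Fin d =>
    algebraMap (MvPolynomial (Fin d) K) (FractionRing (MvPolynomial (Fin d) K))
      (MvPolynomial.X i)) = ⊤ := by
  rw [eq_top_iff]
  intro x _
  obtain ⟨p, q, -, rfl⟩ := IsFractionRing.div_surjective (A := MvPolynomial (Fin d) K) x
  have key : ∀ p : MvPolynomial (Fin d) K,
      algebraMap _ (FractionRing (MvPolynomial (Fin d) K)) p ∈
        IntermediateField.adjoin K (Set.range fun i : Fin d =>
          algebraMap (MvPolynomial (Fin d) K) (FractionRing (MvPolynomial (Fin d) K))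
            (MvPolynomial.X i)) := by
    intro p
    induction p using MvPolynomial.induction_on with
    | C c =>
      rw [← MvPolynomial.algebraMap_eq, ← IsScalarTower.algebraMap_apply]
      exact IntermediateField.algebraMap_mem _ c
    | add p q hp hq => rw [map_add]; exact add_mem hp hq
    | mul_X p i hp =>
      rw [map_mul]; exact mul_mem hp (IntermediateField.subset_adjoin K _ ⟨i, rfl⟩)
  exact div_mem (key p) (key q)

theorem linearAction_C (e : G ≃* (K ≃ₐ[k] K)) {d : ℕ} (τ : G →* GL (Fin d) k) (g : G) (c : K) :
    linearAction e τ g (MvPolynomial.C c) = MvPolynomial.C (e g c) := by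
  simp [linearAction]

theorem linearAction_X (e : G ≃* (K ≃ₐ[k] K)) {d : ℕ} (τ : G →* GL (Fin d) k) (g : G)
    (j : Fin d) : linearAction e τ g (MvPolynomial.X j) = ∑ i, MvPolynomial.C
      (algebraMap k K ((τ g : Matrix (Fin d) (Fin d) k) i j)) * MvPolynomial.X i := by
  simp [linearAction]

/-- The span of the variables is stable, so Speiser's lemma turns them into invariant linear forms,
whatever `τ` is. -/
theorem fixedRational_linearAction [Finite G] (e : G ≃* (K ≃ₐ[k] K)) {d : ℕ}
    (τ : G →* GL (Fin d) k) : FixedRational K d (fracAction (linearAction e τ)) := by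
  refine fixedRational_of_span_stable e _
    (fracAction_algebraMap_field fun g x => linearAction_C e τ g x) _ (fun g j => ?_)
    (adjoin_X_eq_top d) (by simp) ?_
  · rw [fracAction_algebraMap, linearAction_X, map_sum]
    refine Submodule.sum_mem _ fun i _ => ?_
    rw [map_mul, ← MvPolynomial.algebraMap_eq, ← IsScalarTower.algebraMap_apply K,
      ← Algebra.smul_def]
    exact Submodule.smul_mem _ _ (Submodule.subset_span ⟨i, rfl⟩)
  · have h := ((MvPolynomial.algebraicIndependent_X (Fin d) K).map'
      (f := IsScalarTower.toAlgHom K _ (FractionRing (MvPolynomial (Fin d) K)))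
      (IsFractionRing.injective (MvPolynomial (Fin d) K) _)).lift_cardinalMk_le_trdeg
    simpa using h

/-- Function fields with free invariant generators are isomorphic to those of trivial
representations. -/
theorem FixedRational.exists_equiv (e : G ≃* (K ≃ₐ[k] K)) {Ω : Type*} [Field Ω] [Algebra k Ω]
    [Algebra K Ω] {a : G →* (Ω ≃ₐ[k] Ω)}
    (ha : ∀ g x, a g (algebraMap K Ω x) = algebraMap K Ω (e g x)) {d : ℕ}
    (h : FixedRational K d a) :
    ∃ φ : Ω ≃ₐ[K] FractionRing (MvPolynomial (Fin d) K),
      ∀ g x, φ (a g x) = fracAction (linearAction e (1 : G →* GL (Fin d) k)) g (φ x) := by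
  obtain ⟨z, hfix, hz, hgen⟩ := h
  let ψ : FractionRing (MvPolynomial (Fin d) K) ≃ₐ[K] Ω :=
    hz.aevalEquivField.trans ((IntermediateField.equivOfEq hgen).trans IntermediateField.topEquiv)
  have hψ : ∀ p : MvPolynomial (Fin d) K, ψ (algebraMap _ _ p) = MvPolynomial.aeval z p := fun p =>
    hz.aevalEquivField_algebraMap_apply_coe p
  have hpoly : ∀ g (p : MvPolynomial (Fin d) K),
      MvPolynomial.aeval z (linearAction e (1 : G →* GL (Fin d) k) g p) =
        a g (MvPolynomial.aeval z p) := by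
    intro g p
    induction p using MvPolynomial.induction_on with
    | C c => rw [linearAction_C, MvPolynomial.aeval_C, MvPolynomial.aeval_C, ha]
    | add p q hp hq => simp only [map_add, hp, hq]
    | mul_X p i hp =>
      rw [map_mul, map_mul, hp, map_mul, map_mul, linearAction_X]
      simp [Matrix.one_apply, hfix]
  have hequiv : ∀ g y, ψ (fracAction (linearAction e (1 : G →* GL (Fin d) k)) g y) = a g (ψ y) := by
    intro g y
    obtain ⟨p, q, -, rfl⟩ := IsFractionRing.div_surjective (A := MvPolynomial (Fin d) K) y
    simp only [map_div₀, fracAction_algebraMap, hψ, hpoly]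
  refine ⟨ψ.symm, fun g x => ψ.injective ?_⟩
  rw [hequiv, AlgEquiv.apply_symm_apply, AlgEquiv.apply_symm_apply]

/-- By Speiser's lemma, linearisability of all tori with character lattice `M` is the same as their
rationality. -/
theorem toriLinearisable_iff (G M : Type*) [Group G] [Finite G] [AddCommGroup M]
    [Module.Free ℤ M] [DistribMulAction G M] :
    ToriLinearisable.{u} G M ↔ ToriRational.{u} G M := by
  constructor
  · intro h k K _ _ _ _ _ _ e
    obtain ⟨d, τ, φ, hφ⟩ := h k K e
    refine (isRational_torusRing_iff e).2 ⟨d, (fixedRational_linearAction e τ).of_equiv φ.symm ?_⟩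
    intro g x
    apply φ.injective
    rw [hφ, AlgEquiv.apply_symm_apply, AlgEquiv.apply_symm_apply]
  · intro h k K _ _ _ _ _ _ e
    obtain ⟨d, hd⟩ := (isRational_torusRing_iff e).1 (h k K e)
    obtain ⟨φ, hφ⟩ := hd.exists_equiv e (fracAction_algebraMap_field (latticeAction_algebraMap e))
    exact ⟨d, 1, φ, hφ⟩

end Linearisable

/-! ### Subquotients of Galois groups. -/

section Subquotient

/-- A quotient `G'` of a subgroup `S` of a Galois group is again a Galois group, of an extension
whose top field embeds equivariantly. -/
theorem exists_galois_subquotient {k K : Type u} [Field k] [CharZero k] [Field K] [Algebra k K]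
    [FiniteDimensional k K] [IsGalois k K] {Γ G' : Type*} [Group Γ] [Group G'] [Finite G']
    (e : Γ ≃* (K ≃ₐ[k] K)) (S : Subgroup Γ) (π : S →* G') (hπ : Function.Surjective π) :
    ∃ (k' K' : Type u) (_ : Field k') (_ : CharZero k') (_ : Field K') (_ : Algebra k' K')
      (_ : FiniteDimensional k' K') (_ : IsGalois k' K') (e' : G' ≃* (K' ≃ₐ[k'] K'))
      (j : K' →+* K), ∀ (h : S) (x : K'), e h (j x) = j (e' (π h) x) := by
  set N : Subgroup (K ≃ₐ[k] K) := (π.ker.map S.subtype).map e.toMonoidHom with hN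
  set K' := IntermediateField.fixedField N with hK'
  have mem_K' : ∀ x, x ∈ K' ↔ ∀ h : S, π h = 1 → e h x = x := by
    intro x
    rw [hK', IntermediateField.mem_fixedField_iff]
    constructor
    · intro hx h hh
      exact hx _ ⟨_, ⟨h, hh, rfl⟩, rfl⟩
    · rintro hx _ ⟨_, ⟨h, hh, rfl⟩, rfl⟩
      exact hx h hh
  have hstab : ∀ (h : S), ∀ x ∈ K', e h x ∈ K' := by
    intro h x hx
    rw [mem_K'] at hx ⊢
    intro n hn
    have := hx (h⁻¹ * n * h) (by simp [hn])
    rw [Subgroup.coe_mul, Subgroup.coe_mul, map_mul, map_mul, AlgEquiv.mul_apply,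
      AlgEquiv.mul_apply, Subgroup.coe_inv, map_inv] at this
    exact (AlgEquiv.symm_apply_eq (e (h : Γ))).1 this
  have hcongr : ∀ (h h' : S), π h = π h' → ∀ x ∈ K', e h x = e h' x := by
    intro h h' hh x hx
    have := (mem_K' x).1 hx (h'⁻¹ * h) (by simp [hh])
    rw [Subgroup.coe_mul, map_mul, AlgEquiv.mul_apply, Subgroup.coe_inv, map_inv] at this
    exact (AlgEquiv.symm_apply_eq (e (h' : Γ))).1 this
  -- `G'` acts on `K'` through lifts to `S`; `hcongr` makes the result independent of the lift.
  let s : G' → S := Function.surjInv hπ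
  have hs : ∀ g, π (s g) = g := Function.surjInv_eq hπ
  let _ : MulSemiringAction G' K' :=
    { smul := fun g x => ⟨e (s g) x, hstab _ _ x.2⟩
      one_smul := fun x => Subtype.ext ((mem_K' _).1 x.2 _ (hs 1))
      mul_smul := fun g g' x => Subtype.ext ((hcongr _ (s g * s g') (by simp [hs]) x x.2).trans
        (by simp; rfl))
      smul_zero := fun g => Subtype.ext (by change e (s g) (0 : K) = 0; exact map_zero _)
      smul_one := fun g => Subtype.ext (by change e (s g) (1 : K) = 1; exact map_one _)
      smul_add := fun g x y => Subtype.ext (map_add (e (s g)) (x : K) y)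
      smul_mul := fun g x y => Subtype.ext (map_mul (e (s g)) (x : K) y) }
  have smul_def : ∀ (g : G') (x : K'), ((g • x : K') : K) = e (s g) x := fun _ _ => rfl
  -- By the Galois correspondence only `N`, the image of `π.ker`, fixes `K'` pointwise.
  have : FaithfulSMul G' K' := by
    refine ⟨fun {g g'} hgg => ?_⟩
    have hmem : e (s (g⁻¹ * g') : S) ∈ N := by
      rw [← IntermediateField.fixingSubgroup_fixedField N, IntermediateField.mem_fixingSubgroup_iff]
      intro x hx
      have h1 : (g⁻¹ * g') • (⟨x, hx⟩ : K') = ⟨x, hx⟩ := by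
        rw [mul_smul, ← hgg, inv_smul_smul]
      exact congrArg Subtype.val h1
    obtain ⟨_, ⟨h, hh, rfl⟩, heq⟩ := hmem
    have h2 : h = s (g⁻¹ * g') := Subtype.ext (e.injective heq)
    have h3 : g⁻¹ * g' = 1 := by rw [← hs (g⁻¹ * g'), ← h2]; exact hh
    exact (inv_mul_eq_one.1 h3)
  have : CharZero K' := charZero_of_injective_algebraMap (algebraMap k K').injective
  have : CharZero (FixedPoints.subfield G' K') :=
    (FixedPoints.subfield G' K').subtype.charZero
  -- Artin's theorem: `K'` is Galois with group `G'` over its fixed field.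
  refine ⟨FixedPoints.subfield G' K', K', inferInstance, inferInstance, inferInstance,
    inferInstance, inferInstance, inferInstance, FixedPoints.toAlgAutMulEquiv G' K',
    K'.val.toRingHom, fun h x => ?_⟩
  exact hcongr h (s (π h)) (hs _).symm x x.2

end Subquotient

/-! ### Trading fixed variables for permuted ones. -/

section Matrix

variable {k K Γ : Type*} [Field k] [Field K] [Algebra k K] [Group Γ]

/-- Speiser's lemma for a permutation representation: an invertible matrix on whose rows the Galois
group acts through the given permutations. -/
theorem exists_matrix_permuted [Finite Γ] (e : Γ ≃* (K ≃ₐ[k] K)) {n : ℕ}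
    (ρ : Γ →* Equiv.Perm (Fin n)) :
    ∃ B : Matrix (Fin n) (Fin n) K, IsUnit B ∧ ∀ w i t, e w (B i t) = B (ρ w i) t := by
  -- The action on `Kⁿ` combines the Galois action on entries with the permutation of coordinates. A
  -- basis of invariant vectors supplies the columns of `B`.
  have hspan := span_fixed_eq_top (V := Fin n → K) e
    (fun w => { toFun := fun f i => e w (f ((ρ w)⁻¹ i))
                map_zero' := by ext; simp
                map_add' := fun f g => by ext; simp })
    (fun f => by ext; simp) (fun g h f => by ext; simp) (fun g c f => by ext; simp)
  obtain ⟨f, hf, -, hli⟩ := Submodule.exists_fun_fin_finrank_span_eq K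
    {v : Fin n → K | ∀ w, (fun i => e w (v ((ρ w)⁻¹ i))) = v}
  have hm : Module.finrank K (Submodule.span K
      {v : Fin n → K | ∀ w, (fun i => e w (v ((ρ w)⁻¹ i))) = v}) = n := by
    refine (congrArg (fun V : Submodule K (Fin n → K) => Module.finrank K V) hspan).trans ?_
    rw [finrank_top, Module.finrank_fin_fun]
  generalize Module.finrank K (Submodule.span K
      {v : Fin n → K | ∀ w, (fun i => e w (v ((ρ w)⁻¹ i))) = v}) = m at f hm hf hli
  subst hm
  refine ⟨(Matrix.of f).transpose, ?_, fun w i t => ?_⟩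
  · rw [Matrix.isUnit_transpose]
    exact Matrix.linearIndependent_rows_iff_isUnit.1 hli
  · have := congrFun (hf t w) (ρ w i)
    simpa using this

variable (A σ : Type*) [CommRing A] [Algebra K A] {n : ℕ}

/-- The substitution `x_{i,j} ↦ ∑ₜ B i t • x_{t,j}`. -/
noncomputable def mixHom (B : Matrix (Fin n) (Fin n) K) :
    MvPolynomial (Fin n × σ) A →ₐ[A] MvPolynomial (Fin n × σ) A :=
  MvPolynomial.aeval fun p => ∑ t, MvPolynomial.C (algebraMap K A (B p.1 t)) *
    MvPolynomial.X (t, p.2)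

variable {A σ}

theorem mixHom_X (B : Matrix (Fin n) (Fin n) K) (i : Fin n) (j : σ) :
    mixHom A σ B (MvPolynomial.X (i, j)) =
      ∑ t, MvPolynomial.C (algebraMap K A (B i t)) * MvPolynomial.X (t, j) := by
  exact MvPolynomial.aeval_X _ _

theorem mixHom_C (B : Matrix (Fin n) (Fin n) K) (a : A) :
    mixHom A σ B (MvPolynomial.C a) = MvPolynomial.C a := by
  exact MvPolynomial.aeval_C _ _

theorem mixHom_mixHom (B B' : Matrix (Fin n) (Fin n) K) (p : MvPolynomial (Fin n × σ) A) :
    mixHom A σ B (mixHom A σ B' p) = mixHom A σ (B' * B) p := by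
  induction p using MvPolynomial.induction_on with
  | C a => rw [mixHom_C, mixHom_C, mixHom_C]
  | add p q hp hq => simp only [map_add, hp, hq]
  | mul_X p i hp =>
    obtain ⟨i, j⟩ := i
    rw [map_mul, map_mul, map_mul, hp, mixHom_X, mixHom_X]
    congr 1
    simp_rw [map_sum, map_mul, mixHom_C, mixHom_X, Finset.mul_sum, Matrix.mul_apply, map_sum,
      map_mul, Finset.sum_mul, mul_assoc]
    exact Finset.sum_comm

theorem mixHom_one (p : MvPolynomial (Fin n × σ) A) :
    mixHom A σ (1 : Matrix (Fin n) (Fin n) K) p = p := by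
  induction p using MvPolynomial.induction_on with
  | C a => rw [mixHom_C]
  | add p q hp hq => simp only [map_add, hp, hq]
  | mul_X p i hp =>
    obtain ⟨i, j⟩ := i
    rw [map_mul, hp, mixHom_X]
    simp [Matrix.one_apply]

theorem mixHom_injective {B : Matrix (Fin n) (Fin n) K} (hB : IsUnit B) :
    Function.Injective (mixHom A σ B) := by
  obtain ⟨B, rfl⟩ := hB
  refine Function.LeftInverse.injective (g := mixHom A σ (↑B⁻¹ : Matrix (Fin n) (Fin n) K))
    fun p => ?_
  rw [mixHom_mixHom, Units.mul_inv, mixHom_one]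

end Matrix

/-! ### The part of the function field belonging to one index. -/

section Local

variable {k K Γ G M : Type*} [Field k] [Field K] [Algebra k K] [Group Γ] [Group G]
  [AddCommGroup M] [DistribMulAction G M] {n : ℕ}

theorem tmul_single_injective (i : Fin n) :
    Function.Injective fun m : M => m ⊗ₜ[ℤ] (Pi.single i 1 : Fin n → ℤ) := by
  refine Function.LeftInverse.injective
    (g := fun x => TensorProduct.rid ℤ M (TensorProduct.map LinearMap.id (LinearMap.proj i) x))
    fun m => ?_
  simp

variable {K' : Type*} [Field K']

/-- The homomorphism `K'[M] → K[M ⊗ Pₙ]`, `a χᵐ ↦ j(a) χ^{m ⊗ eᵢ}`. -/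
noncomputable def groupRingHom (M : Type*) [AddCommGroup M] (j : K' →+* K) (i : Fin n) :
    AddMonoidAlgebra K' M →+* AddMonoidAlgebra K (M ⊗[ℤ] (Fin n → ℤ)) :=
  (AddMonoidAlgebra.mapDomainRingHom K
    (((TensorProduct.mk ℤ M (Fin n → ℤ)).flip (Pi.single i 1)).toAddMonoidHom)).comp
    (AddMonoidAlgebra.mapRingHom M j)

theorem groupRingHom_single (j : K' →+* K) (i : Fin n) (m : M) (c : K') :
    groupRingHom M j i (AddMonoidAlgebra.single m c) =
      AddMonoidAlgebra.single (m ⊗ₜ Pi.single i 1) (j c) := by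
  simp [groupRingHom]

theorem groupRingHom_injective (j : K' →+* K) (i : Fin n) :
    Function.Injective (groupRingHom M j i) :=
  (AddMonoidAlgebra.mapDomain_injective (tmul_single_injective i)).comp
    (AddMonoidAlgebra.map_injective _ j.injective)

variable {σ : Type*}

/-- The homomorphism `K'[M][x_j] → K[M ⊗ Pₙ][x_{t,j}]` that extends `groupRingHom` by
`x_j ↦ ∑ₜ B i t • x_{t,j}`. -/
noncomputable def polyRingHom (M σ : Type*) [AddCommGroup M] (j : K' →+* K) (i : Fin n)
    (B : Matrix (Fin n) (Fin n) K) :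
    MvPolynomial σ (AddMonoidAlgebra K' M) →+*
      MvPolynomial (Fin n × σ) (AddMonoidAlgebra K (M ⊗[ℤ] (Fin n → ℤ))) :=
  (mixHom _ σ B).toRingHom.comp
    ((MvPolynomial.rename (Prod.mk i)).toRingHom.comp (MvPolynomial.map (groupRingHom M j i)))

theorem polyRingHom_C (j : K' →+* K) (i : Fin n) (B : Matrix (Fin n) (Fin n) K)
    (a : AddMonoidAlgebra K' M) :
    polyRingHom M σ j i B (MvPolynomial.C a) = MvPolynomial.C (groupRingHom M j i a) := by
  change mixHom _ σ B (MvPolynomial.rename _ (MvPolynomial.map _ _)) = _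
  rw [MvPolynomial.map_C, MvPolynomial.rename_C, mixHom_C]

theorem polyRingHom_X (j : K' →+* K) (i : Fin n) (B : Matrix (Fin n) (Fin n) K) (l : σ) :
    polyRingHom M σ j i B (MvPolynomial.X l) = mixHom _ σ B (MvPolynomial.X (i, l)) := by
  change mixHom _ σ B (MvPolynomial.rename _ (MvPolynomial.map _ _)) = _
  rw [MvPolynomial.map_X, MvPolynomial.rename_X]

theorem polyRingHom_injective (j : K' →+* K) (i : Fin n) {B : Matrix (Fin n) (Fin n) K}
    (hB : IsUnit B) : Function.Injective (polyRingHom M σ j i B) :=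
  (mixHom_injective hB).comp ((MvPolynomial.rename_injective _ (Prod.mk_right_injective i)).comp
    (MvPolynomial.map_injective _ (groupRingHom_injective j i)))

variable [DistribMulAction Γ (M ⊗[ℤ] (Fin n → ℤ))]

-- This is the purpose of `B`: the `x_{t,l}` are fixed, while the combinations `∑ₜ B i t • x_{t,l}`
-- are permuted with `i`.
omit [DistribMulAction G M] in
theorem polyAction_mixHom_X (e : Γ ≃* (K ≃ₐ[k] K)) {ρ : Γ →* Wreath G n}
    {B : Matrix (Fin n) (Fin n) K} (hB : ∀ w i t, e w (B i t) = B ((ρ w).right i) t) (w : Γ)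
    (i : Fin n) (l : σ) :
    polyAction (M ⊗[ℤ] (Fin n → ℤ)) (Fin n × σ) e w (mixHom _ σ B (MvPolynomial.X (i, l))) =
      mixHom _ σ B (MvPolynomial.X ((ρ w).right i, l)) := by
  simp_rw [mixHom_X, map_sum, map_mul, polyAction_C, latticeAction_algebraMap, polyAction_X, hB]

theorem polyAction_polyRingHom {k' G' : Type*} [Field k'] [Algebra k' K'] [Group G']
    [DistribMulAction G' M] (e : Γ ≃* (K ≃ₐ[k] K)) {ρ : Γ →* Wreath G n}
    (hρ : ∀ (w : Γ) (p : M ⊗[ℤ] (Fin n → ℤ)), w • p = ρ w • p)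
    {B : Matrix (Fin n) (Fin n) K} (hB : ∀ w i t, e w (B i t) = B ((ρ w).right i) t)
    (e' : G' ≃* (K' ≃ₐ[k'] K')) (j : K' →+* K) {i : Fin n} {h : Γ} {g : G'}
    (hi : (ρ h).right i = i) (hg : ∀ m : M, g • m = (ρ h).left i • m)
    (hj : ∀ x, e h (j x) = j (e' g x)) (p : MvPolynomial σ (AddMonoidAlgebra K' M)) :
    polyAction (M ⊗[ℤ] (Fin n → ℤ)) (Fin n × σ) e h (polyRingHom M σ j i B p) =
      polyRingHom M σ j i B (polyAction M σ e' g p) := by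
  induction p using MvPolynomial.induction_on with
  | C a =>
    rw [polyRingHom_C, polyAction_C, polyAction_C, polyRingHom_C]
    congr 1
    induction a using AddMonoidAlgebra.induction_linear with
    | zero => simp
    | add a b ha hb => simp only [map_add, ha, hb]
    | single m c =>
      rw [groupRingHom_single, latticeAction_single, latticeAction_single, groupRingHom_single,
        hj, hρ, hg]
      congr 1
      refine (wreathMap_apply n (ρ h) m i).trans ?_
      rw [hi]
  | add p q hp hq => simp only [map_add, hp, hq]
  | mul_X p l hp =>
    rw [map_mul, map_mul, hp, map_mul, map_mul, polyAction_X, polyRingHom_X,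
      polyAction_mixHom_X e hB, hi]

variable [Module.Free ℤ M]

/-- Elements of `K(M ⊗ Pₙ)(x)`, invariant under the stabiliser of `i`, that generate the part of
this field that belongs to the index `i`. -/
def HasLocalGenerators (σ : Type*) (d : ℕ) (e : Γ ≃* (K ≃ₐ[k] K)) (ρ : Γ →* Wreath G n)
    (B : Matrix (Fin n) (Fin n) K) (i : Fin n) : Prop :=
  ∃ z : Fin d →
      FractionRing (MvPolynomial (Fin n × σ) (AddMonoidAlgebra K (M ⊗[ℤ] (Fin n → ℤ)))),
    (∀ h, (ρ h).right i = i → ∀ l,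
      fracAction (polyAction (M ⊗[ℤ] (Fin n → ℤ)) (Fin n × σ) e) h (z l) = z l) ∧
    (∀ m : M, algebraMap (MvPolynomial (Fin n × σ) (AddMonoidAlgebra K (M ⊗[ℤ] (Fin n → ℤ)))) _
      (MvPolynomial.C (AddMonoidAlgebra.single (m ⊗ₜ Pi.single i 1) 1)) ∈
        IntermediateField.adjoin K (Set.range z)) ∧
    ∀ l : σ, algebraMap (MvPolynomial (Fin n × σ) (AddMonoidAlgebra K (M ⊗[ℤ] (Fin n → ℤ)))) _
      (mixHom _ σ B (MvPolynomial.X (i, l))) ∈ IntermediateField.adjoin K (Set.range z)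

/-- The embedding of `K'(M)(x)` is equivariant for the stabiliser of `i`, which acts on the source
through `G'`. Hence it carries invariant generators to stabiliser-invariant elements. -/
theorem FixedRational.hasLocalGenerators {k' G' : Type*} [Field k'] [Algebra k' K'] [Group G']
    [DistribMulAction G' M] (e : Γ ≃* (K ≃ₐ[k] K)) {ρ : Γ →* Wreath G n}
    (hρ : ∀ (w : Γ) (p : M ⊗[ℤ] (Fin n → ℤ)), w • p = ρ w • p)
    {B : Matrix (Fin n) (Fin n) K} (hBu : IsUnit B)
    (hB : ∀ w i t, e w (B i t) = B ((ρ w).right i) t)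
    (e' : G' ≃* (K' ≃ₐ[k'] K')) (j : K' →+* K) {i : Fin n}
    (hstab : ∀ h, (ρ h).right i = i → ∃ g : G', (∀ m : M, g • m = (ρ h).left i • m) ∧
      ∀ x, e h (j x) = j (e' g x)) {d : ℕ}
    (H : FixedRational K' d (fracAction (polyAction M σ e'))) :
    HasLocalGenerators (M := M) σ d e ρ B i := by
  obtain ⟨z, hfix, -, hgen⟩ := H
  have hinj : Function.Injective ((algebraMap _ (FractionRing (MvPolynomial (Fin n × σ)
      (AddMonoidAlgebra K (M ⊗[ℤ] (Fin n → ℤ)))))).comp (polyRingHom M σ j i B)) :=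
    (IsFractionRing.injective _ _).comp (polyRingHom_injective j i hBu)
  set Ψ : FractionRing (MvPolynomial σ (AddMonoidAlgebra K' M)) →+*
    FractionRing (MvPolynomial (Fin n × σ) (AddMonoidAlgebra K (M ⊗[ℤ] (Fin n → ℤ)))) :=
      IsFractionRing.lift hinj with hΨ
  have Ψ_alg : ∀ p, Ψ (algebraMap _ _ p) = algebraMap _ _ (polyRingHom M σ j i B p) := fun p =>
    IsFractionRing.lift_algebraMap hinj p
  have hmem : ∀ x, Ψ x ∈ IntermediateField.adjoin K (Set.range fun l => Ψ (z l)) := by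
    intro x
    have hx : x ∈ IntermediateField.adjoin K' (Set.range z) := hgen ▸ trivial
    induction hx using IntermediateField.adjoin_induction with
    | mem y hy =>
      obtain ⟨l, rfl⟩ := hy
      exact IntermediateField.subset_adjoin K _ ⟨l, rfl⟩
    | algebraMap c =>
      have : Ψ (algebraMap K' _ c) = algebraMap K _ (j c) := by
        rw [IsScalarTower.algebraMap_apply K' (MvPolynomial σ (AddMonoidAlgebra K' M)), Ψ_alg,
          MvPolynomial.algebraMap_apply, polyRingHom_C, AddMonoidAlgebra.coe_algebraMap,
          IsScalarTower.algebraMap_apply K (MvPolynomial (Fin n × σ)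
            (AddMonoidAlgebra K (M ⊗[ℤ] (Fin n → ℤ)))), MvPolynomial.algebraMap_apply,
          AddMonoidAlgebra.coe_algebraMap]
        simp [groupRingHom_single]
      rw [this]
      exact IntermediateField.algebraMap_mem _ _
    | add y z _ _ hy hz => rw [map_add]; exact add_mem hy hz
    | inv y _ hy => rw [map_inv₀]; exact inv_mem hy
    | mul y z _ _ hy hz => rw [map_mul]; exact mul_mem hy hz
  refine ⟨fun l => Ψ (z l), fun h hi l => ?_, fun m => ?_, fun l => ?_⟩
  · obtain ⟨g, hg, hj⟩ := hstab h hi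
    have hequiv : ∀ x, fracAction (polyAction (M ⊗[ℤ] (Fin n → ℤ)) (Fin n × σ) e) h (Ψ x) =
        Ψ (fracAction (polyAction M σ e') g x) := by
      intro x
      obtain ⟨p, q, -, rfl⟩ :=
        IsFractionRing.div_surjective (A := MvPolynomial σ (AddMonoidAlgebra K' M)) x
      simp only [map_div₀, Ψ_alg, fracAction_algebraMap,
        polyAction_polyRingHom e hρ hB e' j hi hg hj]
    rw [hequiv, hfix]
  · have := hmem (algebraMap (MvPolynomial σ (AddMonoidAlgebra K' M)) _
      (MvPolynomial.C (AddMonoidAlgebra.single m 1)))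
    rwa [Ψ_alg, polyRingHom_C, groupRingHom_single, map_one] at this
  · have := hmem (algebraMap (MvPolynomial σ (AddMonoidAlgebra K' M)) _ (MvPolynomial.X l))
    rwa [Ψ_alg, polyRingHom_X] at this

end Local

/-! ### From the stabilisers to the whole group. -/

section Global

variable {k K Γ G M : Type*} [Field k] [Field K] [Algebra k K] [Group Γ] [Group G]
  [AddCommGroup M] [DistribMulAction G M] {n : ℕ} {σ : Type*}

theorem span_tmul_single_eq_top (M : Type*) [AddCommGroup M] (n : ℕ) : Submodule.span ℤ
    {p : M ⊗[ℤ] (Fin n → ℤ) | ∃ m i, m ⊗ₜ Pi.single i 1 = p} = ⊤ := by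
  rw [eq_top_iff]
  intro x _
  induction x using TensorProduct.induction_on with
  | zero => exact Submodule.zero_mem _
  | add x y hx hy => exact Submodule.add_mem _ (hx trivial) (hy trivial)
  | tmul m p =>
    have hp : m ⊗ₜ[ℤ] p = ∑ i, (p i • m) ⊗ₜ[ℤ] (Pi.single i 1 : Fin n → ℤ) := by
      conv_lhs => rw [pi_eq_sum_univ' p, TensorProduct.tmul_sum]
      exact Finset.sum_congr rfl fun i _ => (TensorProduct.smul_tmul _ _ _).symm
    rw [hp]
    exact Submodule.sum_mem _ fun i _ => Submodule.subset_span ⟨_, i, rfl⟩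

/-- The basis `b_j ⊗ e_i` of `M ⊗ Pₙ`. -/
noncomputable def tensorBasis (M : Type*) [AddCommGroup M] [Module.Free ℤ M] [Module.Finite ℤ M]
    (n : ℕ) : Module.Basis (Fin (Module.finrank ℤ M) × Fin n) ℤ (M ⊗[ℤ] (Fin n → ℤ)) :=
  (Module.finBasis ℤ M).tensorProduct (Pi.basisFun ℤ (Fin n))

instance tensor_finite (M : Type*) [AddCommGroup M] [Module.Free ℤ M] [Module.Finite ℤ M]
    (n : ℕ) : Module.Finite ℤ (M ⊗[ℤ] (Fin n → ℤ)) :=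
  Module.Finite.of_basis (tensorBasis M n)

variable [DistribMulAction Γ (M ⊗[ℤ] (Fin n → ℤ))] [Module.Free ℤ M]

/-- Local generators for representatives of the orbits of the Galois group on the indices spread
out to free invariant generators. -/
theorem fixedRational_of_hasLocalGenerators [Finite Γ] [Finite σ] [Module.Finite ℤ M]
    (e : Γ ≃* (K ≃ₐ[k] K)) {ρ : Γ →* Wreath G n}
    (hρ : ∀ (w : Γ) (p : M ⊗[ℤ] (Fin n → ℤ)), w • p = ρ w • p)
    {B : Matrix (Fin n) (Fin n) K} (hBu : IsUnit B)
    (hB : ∀ w i t, e w (B i t) = B ((ρ w).right i) t) (r : Fin n → Fin n) (w : Fin n → Γ)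
    (hr : ∀ γ i, r ((ρ γ).right i) = r i) (hw : ∀ i, (ρ (w i)).right (r i) = i)
    (H : ∀ i, HasLocalGenerators (M := M) σ (Module.finrank ℤ M + Nat.card σ) e ρ B (r i)) :
    FixedRational K (n * (Module.finrank ℤ M + Nat.card σ))
      (fracAction (polyAction (M ⊗[ℤ] (Fin n → ℤ)) (Fin n × σ) e)) := by
  set d := Module.finrank ℤ M + Nat.card σ with hd
  set A := MvPolynomial (Fin n × σ) (AddMonoidAlgebra K (M ⊗[ℤ] (Fin n → ℤ))) with hA
  set a := fracAction (polyAction (M ⊗[ℤ] (Fin n → ℤ)) (Fin n × σ) e) with ha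
  have haK : ∀ g x, a g (algebraMap K _ x) = algebraMap K _ (e g x) :=
    fracAction_algebraMap_field (polyAction_algebraMap e)
  have hrr : ∀ i, r (r i) = r i := fun i => by
    conv_rhs => rw [← hw i, hr]
  choose z' hz' using H
  -- The choices made for two indices of one orbit may differ. Only those at representatives are
  -- kept, which is possible since `r` is idempotent.
  obtain ⟨z, hfix, hχ, hu⟩ : ∃ z : Fin n → Fin d → FractionRing A,
      (∀ i h, (ρ h).right (r i) = r i → ∀ l, a h (z (r i) l) = z (r i) l) ∧
      (∀ i (m : M), algebraMap A _
        (MvPolynomial.C (AddMonoidAlgebra.single (m ⊗ₜ Pi.single (r i) 1) 1)) ∈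
          IntermediateField.adjoin K (Set.range (z (r i)))) ∧
      ∀ i (l : σ), algebraMap A _ (mixHom _ σ B (MvPolynomial.X (r i, l))) ∈
        IntermediateField.adjoin K (Set.range (z (r i))) := by
    refine ⟨z', fun i => ?_, fun i => ?_, fun i => ?_⟩
    · have := (hz' (r i)).1; rwa [hrr] at this
    · have := (hz' (r i)).2.1; rwa [hrr] at this
    · have := (hz' (r i)).2.2; rwa [hrr] at this
  -- Translates by coset representatives; different coset representatives would give the same
  -- family, since `z (r i)` is invariant under the stabiliser.
  set v : Fin n × Fin d → FractionRing A := fun p => a (w p.1) (z (r p.1) p.2) with hv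
  have hperm : ∀ γ i l, a γ (v (i, l)) = v ((ρ γ).right i, l) := by
    intro γ i l
    set i' := (ρ γ).right i with hi'
    -- Both `γ * w i` and `w i'` carry the representative `r i` to `i'`.
    have hstab : (ρ ((w i')⁻¹ * (γ * w i))).right (r i) = r i := by
      have h1 : (ρ ((w i')⁻¹ * (γ * w i))).right (r i) = (ρ (w i')).right⁻¹ i' := by
        simp only [map_mul, map_inv, SemidirectProduct.mul_right, SemidirectProduct.inv_right,
          Equiv.Perm.mul_apply, hw, hi']
      rw [h1, Equiv.Perm.inv_eq_iff_eq, ← hr γ i, ← hi', hw]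
    have h2 := congrArg (a (w i')) (hfix i _ hstab l)
    rw [← AlgEquiv.mul_apply, ← map_mul, mul_inv_cancel_left, map_mul, AlgEquiv.mul_apply] at h2
    change a γ (a (w i) (z (r i) l)) = a (w i') (z (r i') l)
    rw [h2, hi', hr]
  set E := IntermediateField.adjoin K (Set.range v) with hE
  have hmove : ∀ i, ∀ x ∈ IntermediateField.adjoin K (Set.range (z (r i))), a (w i) x ∈ E := by
    intro i x hx
    induction hx using IntermediateField.adjoin_induction with
    | mem y hy =>
      obtain ⟨l, rfl⟩ := hy
      exact IntermediateField.subset_adjoin K _ ⟨(i, l), rfl⟩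
    | algebraMap c => rw [haK]; exact E.algebraMap_mem _
    | add y z _ _ hy hz => rw [map_add]; exact add_mem hy hz
    | inv y _ hy => rw [map_inv₀]; exact inv_mem hy
    | mul y z _ _ hy hz => rw [map_mul]; exact mul_mem hy hz
  have huE : ∀ i l, algebraMap A _ (mixHom _ σ B (MvPolynomial.X (i, l))) ∈ E := by
    intro i l
    have := hmove i _ (hu i l)
    rwa [ha, fracAction_algebraMap, polyAction_mixHom_X e hB, hw] at this
  have hgen : E = ⊤ := by
    refine eq_top_of_single_mem E (span_tmul_single_eq_top M n) ?_ ?_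
    · rintro _ ⟨m, i, rfl⟩
      -- The character is twisted in advance so that `w i` takes it exactly to `m ⊗ eᵢ`.
      have := hmove i _ (hχ i (((ρ (w i)).left i)⁻¹ • m))
      rw [ha, fracAction_algebraMap, polyAction_C, latticeAction_single, map_one, hρ] at this
      have h3 : ρ (w i) • ((((ρ (w i)).left i)⁻¹ • m) ⊗ₜ[ℤ] (Pi.single (r i) 1 : Fin n → ℤ)) =
          m ⊗ₜ Pi.single i 1 := by
        refine (wreathMap_apply n (ρ (w i)) _ (r i)).trans ?_
        rw [hw, smul_inv_smul]
      rwa [h3] at this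
    · rintro ⟨t, l⟩
      obtain ⟨B, rfl⟩ := hBu
      -- The inverse of `B` recovers the original variables from the permuted ones.
      have h4 : (MvPolynomial.X (t, l) : A) = ∑ i, MvPolynomial.C
          (algebraMap K _ ((↑B⁻¹ : Matrix (Fin n) (Fin n) K) t i)) *
            mixHom _ σ (B : Matrix (Fin n) (Fin n) K) (MvPolynomial.X (i, l)) := by
        rw [← mixHom_one (K := K) (MvPolynomial.X (t, l) : A), ← Units.inv_mul B, ← mixHom_mixHom,
          mixHom_X]
        simp_rw [map_sum, map_mul, mixHom_C]
      rw [h4, map_sum]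
      refine sum_mem fun i _ => ?_
      rw [map_mul]
      refine mul_mem ?_ (huE i l)
      rw [← MvPolynomial.algebraMap_eq, ← IsScalarTower.algebraMap_apply,
        ← IsScalarTower.algebraMap_apply]
      exact E.algebraMap_mem _
  refine fixedRational_of_span_stable e a haK v ?_ hgen (by simp) ?_
  · rintro γ ⟨i, l⟩
    rw [hperm]
    exact Submodule.subset_span ⟨_, rfl⟩
  · rw [trdeg_fractionRing, Nat.cast_le, hd, Module.finrank_eq_card_basis (tensorBasis M n),
      Fintype.card_prod, Fintype.card_fin, Fintype.card_fin, Nat.card_prod, Nat.card_fin]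
    exact le_of_eq (by ring)

end Global

/-! ### Stabilisers of indices and their tori. -/

section Wreath

theorem exists_orbit_representatives {Γ X : Type*} [Group Γ] (f : Γ →* Equiv.Perm X) :
    ∃ (r : X → X) (w : X → Γ), (∀ γ i, r (f γ i) = r i) ∧ ∀ i, f (w i) (r i) = i := by
  let _ : MulAction Γ X := MulAction.compHom X f
  let r : X → X := fun i => (Quotient.mk (MulAction.orbitRel Γ X) i).out
  have h : ∀ i, ∃ γ : Γ, f γ (r i) = i := fun i =>
    (MulAction.orbitRel Γ X).symm (Quotient.mk_out (s := MulAction.orbitRel Γ X) i)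
  choose w hw using h
  refine ⟨r, w, fun γ i => ?_, hw⟩
  have : Quotient.mk (MulAction.orbitRel Γ X) (f γ i) = Quotient.mk (MulAction.orbitRel Γ X) i :=
    Quotient.sound ⟨γ, rfl⟩
  exact congrArg Quotient.out this

variable {Γ G M : Type*} [Group Γ] [Group G] [AddCommGroup M] [DistribMulAction G M] {n : ℕ}

/-- The stabiliser of the index `i`. -/
def indexStabilizer (ρ : Γ →* Wreath G n) (i : Fin n) : Subgroup Γ where
  carrier := {h | (ρ h).right i = i}
  mul_mem' {a b} ha hb := by
    simp only [Set.mem_ofPred_eq] at ha hb ⊢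
    rw [map_mul, SemidirectProduct.mul_right, Equiv.Perm.mul_apply, hb, ha]
  one_mem' := by simp
  inv_mem' {a} ha := by
    simp only [Set.mem_ofPred_eq] at ha ⊢
    rw [map_inv, SemidirectProduct.inv_right, Equiv.Perm.inv_eq_iff_eq, ha]

/-- The projection of the stabiliser of the index `i` to the `i`-th factor `G`. -/
def indexProjection (ρ : Γ →* Wreath G n) (i : Fin n) : indexStabilizer ρ i →* G where
  toFun h := (ρ h).left i
  map_one' := by simp
  map_mul' a b := by
    have ha : (ρ a).right.symm i = i := (Equiv.symm_apply_eq _).2 (Eq.symm a.2)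
    rw [Subgroup.coe_mul, map_mul]
    change (ρ a).left i * (ρ b).left ((ρ a).right.symm i) = _
    rw [ha]

variable [Module.Free ℤ M] [DistribMulAction Γ (M ⊗[ℤ] (Fin n → ℤ))]

/-- The extension `K'/k'` is produced before `σ` and `d`, because in the stable case the number of
extra variables depends on the torus over `k'`. The group `G'` is left free: it is `G` for the full
wreath product and the image of the stabiliser for a subgroup. -/
theorem exists_local_torus {k K : Type u} [Field k] [CharZero k] [Field K] [Algebra k K]
    [FiniteDimensional k K] [IsGalois k K] (e : Γ ≃* (K ≃ₐ[k] K)) (ρ : Γ →* Wreath G n)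
    (hρ : ∀ (w : Γ) (p : M ⊗[ℤ] (Fin n → ℤ)), w • p = ρ w • p) (i : Fin n)
    {G' : Type*} [Group G'] [Finite G'] [DistribMulAction G' M] (π : indexStabilizer ρ i →* G')
    (hπ : Function.Surjective π)
    (hπM : ∀ h (m : M), π h • m = indexProjection ρ i h • m) :
    ∃ (k' K' : Type u) (_ : Field k') (_ : CharZero k') (_ : Field K') (_ : Algebra k' K')
      (_ : FiniteDimensional k' K') (_ : IsGalois k' K') (e' : G' ≃* (K' ≃ₐ[k'] K')),
      ∀ {σ : Type} {d : ℕ}, FixedRational K' d (fracAction (polyAction M σ e')) →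
        ∀ {B : Matrix (Fin n) (Fin n) K}, IsUnit B →
          (∀ w i t, e w (B i t) = B ((ρ w).right i) t) →
            HasLocalGenerators (M := M) σ d e ρ B i := by
  obtain ⟨k', K', i1, i2, i3, i4, i5, i6, e', j, hj⟩ :=
    exists_galois_subquotient e (indexStabilizer ρ i) π hπ
  refine ⟨k', K', i1, i2, i3, i4, i5, i6, e', fun {σ d} H {B} hBu hB => ?_⟩
  exact H.hasLocalGenerators e hρ hBu hB e' j fun h hi =>
    ⟨π ⟨h, hi⟩, fun m => hπM ⟨h, hi⟩ m, fun x => hj ⟨h, hi⟩ x⟩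

theorem FixedRational.eq_finrank_add {k K G : Type*} [Field k] [Field K] [Algebra k K] [Group G]
    [DistribMulAction G M] [Module.Finite ℤ M] {σ : Type*} [Finite σ] {e : G ≃* (K ≃ₐ[k] K)}
    {d : ℕ} (h : FixedRational K d (fracAction (polyAction M σ e))) :
    d = Module.finrank ℤ M + Nat.card σ := by
  have := h.trdeg_eq
  rw [trdeg_fractionRing] at this
  exact_mod_cast this.symm

/-- In the full wreath product, the stabiliser of the index `i` projects onto `G`. -/
theorem indexProjection_id_surjective (i : Fin n) :
    Function.Surjective (indexProjection (MonoidHom.id (Wreath G n)) i) := fun g =>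
  ⟨⟨SemidirectProduct.inl (Function.const _ g), by
    change (1 : Equiv.Perm (Fin n)) i = i; rfl⟩, rfl⟩

instance finite_wreath [Finite G] : Finite (Wreath G n) :=
  Finite.of_equiv _ SemidirectProduct.equivProd.symm

end Wreath

/-! ### Rational, stably rational and hereditarily rational lattices. -/

section Main

variable {G M : Type*} [Group G] [Finite G] [AddCommGroup M] [Module.Free ℤ M]
  [Module.Finite ℤ M] [DistribMulAction G M] {n : ℕ}

/-- If all tori with character lattice `M` become rational after adding variables, in number
depending on the torus, so do all tori with character lattice `M ⊗ Pₙ`; the admissible numbers `s`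
of variables are described by the predicate `Q`. -/
theorem fixedRational_wreath (Q : ℕ → Prop)
    (h : ∀ (k' K' : Type u) [Field k'] [CharZero k'] [Field K'] [Algebra k' K']
      [FiniteDimensional k' K'] [IsGalois k' K'] (e' : G ≃* (K' ≃ₐ[k'] K')),
      ∃ s, Q s ∧ ∃ d, FixedRational K' d (fracAction (polyAction M (Fin s) e')))
    (hQ : ∃ s, Q s) {k K : Type u} [Field k] [CharZero k] [Field K]
    [Algebra k K] [FiniteDimensional k K] [IsGalois k K] (e : Wreath G n ≃* (K ≃ₐ[k] K)) :
    ∃ s, Q s ∧ ∃ d, FixedRational K d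
      (fracAction (polyAction (M ⊗[ℤ] (Fin n → ℤ)) (Fin n × Fin s) e)) := by
  have hρ : ∀ (w : Wreath G n) (p : M ⊗[ℤ] (Fin n → ℤ)), w • p = MonoidHom.id _ w • p :=
    fun _ _ => rfl
  obtain ⟨B, hBu, hB⟩ := exists_matrix_permuted e SemidirectProduct.rightHom
  rcases isEmpty_or_nonempty (Fin n) with hn | ⟨⟨i₀⟩⟩
  -- For `n = 0` there is no local torus to supply `s`, so any admissible value serves.
  · obtain ⟨s, hs⟩ := hQ
    exact ⟨s, hs, _, fixedRational_of_hasLocalGenerators e hρ hBu hB id isEmptyElim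
      (fun _ => isEmptyElim) isEmptyElim isEmptyElim⟩
  · obtain ⟨k', K', _, _, _, _, _, _, e', H⟩ := exists_local_torus e (MonoidHom.id _) hρ i₀
      (indexProjection (MonoidHom.id (Wreath G n)) i₀) (indexProjection_id_surjective i₀)
      fun _ _ => rfl
    obtain ⟨s, hs, d, hd⟩ := h k' K' e'
    obtain rfl := hd.eq_finrank_add
    -- The action on indices is transitive, so a single torus, and hence a single `s`, suffices; the
    -- transposition of `i₀` and `i` moves `i₀` to `i`.
    exact ⟨s, hs, _, fixedRational_of_hasLocalGenerators e hρ hBu hB (fun _ => i₀)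
      (fun i => SemidirectProduct.inr (Equiv.swap i₀ i)) (fun _ _ => rfl)
      (fun i => Equiv.swap_apply_left i₀ i) fun _ => H hd hBu hB⟩

theorem toriRational_wreath (h : ToriRational.{u} G M) :
    ToriRational.{u} (Wreath G n) (M ⊗[ℤ] (Fin n → ℤ)) := by
  intro k K _ _ _ _ _ _ e
  obtain ⟨s, rfl, hs⟩ := fixedRational_wreath (· = 0) (fun k' K' _ _ _ _ _ _ e' =>
    ⟨0, rfl, (isRational_torusRing_iff_of_isEmpty e').1 (h k' K' e')⟩) ⟨0, rfl⟩ e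
  exact (isRational_torusRing_iff_of_isEmpty e).2 hs

theorem toriStablyRational_wreath (h : ToriStablyRational.{u} G M) :
    ToriStablyRational.{u} (Wreath G n) (M ⊗[ℤ] (Fin n → ℤ)) := by
  intro k K _ _ _ _ _ _ e
  obtain ⟨s, -, hs⟩ := fixedRational_wreath (fun _ => True) (fun k' K' _ _ _ _ _ _ e' => by
    obtain ⟨s, hs⟩ := h k' K' e'
    exact ⟨s, trivial, (isRational_mvPolynomial_torusRing_iff (Equiv.refl _) e').1 hs⟩)
    ⟨0, trivial⟩ e
  exact ⟨n * s, (isRational_mvPolynomial_torusRing_iff finProdFinEquiv.symm e).2 hs⟩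

/-- A subgroup may have several orbits of indices, and the stabiliser of each representative
projects to a possibly proper subgroup of `G`. Heredity makes each local torus rational. -/
theorem hereditarilyRational_wreath (h : HereditarilyRational.{u} G M) :
    HereditarilyRational.{u} (Wreath G n) (M ⊗[ℤ] (Fin n → ℤ)) := by
  intro S k K _ _ _ _ _ _ e
  have hρ : ∀ (w : S) (p : M ⊗[ℤ] (Fin n → ℤ)), w • p = S.subtype w • p := fun _ _ => rfl
  obtain ⟨B, hBu, hB⟩ := exists_matrix_permuted e (SemidirectProduct.rightHom.comp S.subtype)
  obtain ⟨r, w, hr, hw⟩ := exists_orbit_representatives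
    (SemidirectProduct.rightHom.comp S.subtype)
  refine (isRational_torusRing_iff_of_isEmpty (σ := Fin n × Fin 0) e).2
    ⟨_, fixedRational_of_hasLocalGenerators e hρ hBu hB r w hr hw fun i => ?_⟩
  obtain ⟨k', K', _, _, _, _, _, _, e', H⟩ := exists_local_torus (M := M) e S.subtype hρ (r i)
    (indexProjection S.subtype (r i)).rangeRestrict (MonoidHom.rangeRestrict_surjective _)
    fun _ _ => rfl
  obtain ⟨d, hd⟩ := (isRational_torusRing_iff_of_isEmpty (σ := Fin 0) e').1 (h _ k' K' e')
  obtain rfl := hd.eq_finrank_add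
  exact H hd hBu hB

end Main

end WreathTorus

theorem mainTheorem10 (G M : Type*) [Group G] [Finite G] [AddCommGroup M] [Module.Free ℤ M]
    [Module.Finite ℤ M] [DistribMulAction G M] :
    (∀ n : ℕ,
      (WreathTorus.ToriRational.{u} G M →
        WreathTorus.ToriRational.{u} (WreathTorus.Wreath G n) (M ⊗[ℤ] (Fin n → ℤ))) ∧
      (WreathTorus.ToriStablyRational.{u} G M →
        WreathTorus.ToriStablyRational.{u} (WreathTorus.Wreath G n) (M ⊗[ℤ] (Fin n → ℤ))) ∧
      (WreathTorus.ToriLinearisable.{u} G M →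
        WreathTorus.ToriLinearisable.{u} (WreathTorus.Wreath G n) (M ⊗[ℤ] (Fin n → ℤ)))) ∧
    (WreathTorus.HereditarilyRational.{u} G M →
      WreathTorus.HereditarilyRational.{u} (WreathTorus.Wreath G 2) (M ⊗[ℤ] (Fin 2 → ℤ))) := by
  refine ⟨fun n => ⟨WreathTorus.toriRational_wreath, WreathTorus.toriStablyRational_wreath,
    fun h => ?_⟩, WreathTorus.hereditarilyRational_wreath⟩
  rw [WreathTorus.toriLinearisable_iff] at h ⊢
  exact WreathTorus.toriRational_wreath h
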